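/- Let $k$ be an arbitrary field, let $\bar k$ be a separable closure of $k$, and put $G_k=\mathrm{Gal}(\bar k/k)$. Let $X$ be a smooth and geometrically irreducible variety over $k$ (a variety is a separated scheme of finite type over $k$), with function field $k(X)$. Put $\bar k(X)=k(X)\otimes_k\bar k$, a field on which $G_k$ acts through the second factor. Let $\overline{k(X)}$ be a separable closure of $\bar k(X)$ and let $\bar k(X)^{\mathrm{ab}}$ be the maximal abelian subextension of $\overline{k(X)}/\bar k(X)$. The elementary obstruction $\mathrm{ob}(X)\in \mathrm{Ext}^1_{G_k}\big(\bar k(X)^\star/\bar k^\star,\bar k^\star\big)$ is the class, in the $\mathrm{Ext}^1$ of discrete $G_k$-modules, of the extension $$1\to \bar k^\star\to \bar k(X)^\star\to \bar k(X)^\star/\bar k^\star\to 1.$$ If $\mathrm{ob}(X)=0$, then the exact sequence of profinite groups $$1\to \mathrm{Gal}\big(\bar k(X)^{\mathrm{ab}}/\bar k(X)\big)\to \mathrm{Gal}\big(\bar k(X)^{\mathrm{ab}}/k(X)\big)\to G_k\to 1$$ splits, i.e. the last map, given by restriction of automorphisms to $\bar k$, has a section which is a continuous group homomorphism. -/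

import Mathlib

universe u

namespace BirationalSections

open CategoryTheory Limits AlgebraicGeometry TensorProduct

/-! ### Smooth geometrically irreducible schemes over a field -/

/-- A smooth algebra over a field is reduced. -/
theorem isReduced_of_smooth (k A : Type*) [Field k] [CommRing A] [Algebra k A]
    [Algebra.Smooth k A] : IsReduced A := by
  refine ⟨fun n hn => ?_⟩
  have hnil : IsNilpotent (n ⊗ₜ[k] (Polynomial.X : Polynomial k)) := by
    obtain ⟨m, hm⟩ := hn
    exact ⟨m, by rw [Algebra.TensorProduct.tmul_pow, hm, TensorProduct.zero_tmul]⟩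
  have hint : IsIntegral A (n ⊗ₜ[k] (Polynomial.X : Polynomial k)) := by
    obtain ⟨m, hm⟩ := hnil
    exact ⟨Polynomial.X ^ m, Polynomial.monic_X_pow m, by simp [hm]⟩
  obtain ⟨y, hy⟩ := (TensorProduct.toIntegralClosure_bijective_of_smooth (R := k) (S := A)
    (B := Polynomial k)).2 ⟨_, hint⟩
  have hy' := congrArg Subtype.val hy
  let L : A ⊗[k] Polynomial k →ₗ[k] A ⊗[k] k :=
    LinearMap.lTensor A (Polynomial.lcoeff k 1)
  have hL : ∀ y : A ⊗[k] integralClosure k (Polynomial k),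
      L (TensorProduct.toIntegralClosure k A (Polynomial k) y).1 = 0 := by
    intro y
    induction y with
    | zero => simp
    | add x y hx hy => simp only [map_add, Subalgebra.coe_add, hx, hy, add_zero]
    | tmul a b =>
      have hb : IsIntegral k b.1 := b.2
      have hdeg : b.1.natDegree = 0 := by
        by_contra h
        exact Polynomial.transcendental b.1 h
          (mem_nonZeroDivisors_of_ne_zero (Polynomial.leadingCoeff_ne_zero.2 fun h' =>
            h (by rw [h', Polynomial.natDegree_zero]))) hb.isAlgebraic
      have : (TensorProduct.toIntegralClosure k A (Polynomial k) (a ⊗ₜ b)).1 = a ⊗ₜ b.1 := rfl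
      rw [this]
      have hc : b.1.coeff 1 = 0 := Polynomial.coeff_eq_zero_of_natDegree_lt (by omega)
      simp [L, hc]
  have h0 := hL y
  rw [hy'] at h0
  have h1 : n ⊗ₜ[k] (1 : k) = 0 := by simpa [L] using h0
  simpa using congrArg (TensorProduct.rid k A) h1

/-- `k(X) ⊗[k] F` is a field for every algebraic extension `F` of `k`: it is a domain because `X` is
smooth and geometrically irreducible. -/
theorem isField_tensorProduct (k A K F : Type*) [Field k] [CommRing A] [IsDomain A] [Algebra k A]
    [Field K] [Algebra k K] [Algebra A K] [IsScalarTower k A K] [IsFractionRing A K]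
    [Field F] [Algebra k F] [Algebra.IsAlgebraic k F] [IsDomain (A ⊗[k] F)] :
    IsField (K ⊗[k] F) := by
  let φ : A ⊗[k] F →ₐ[A] K ⊗[k] F :=
    Algebra.TensorProduct.map (Algebra.ofId A K) (AlgHom.id k F)
  have hφ : Function.Injective φ := by
    have := Module.Flat.rTensor_preserves_injective_linearMap (M := F)
      ((IsScalarTower.toAlgHom k A K).toLinearMap) (IsFractionRing.injective A K)
    exact this
  have key : ∀ x : K ⊗[k] F, ∃ s : A, s ≠ 0 ∧ ∃ y, φ y = s • x := by
    intro x
    induction x with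
    | zero => exact ⟨1, one_ne_zero, 0, by simp⟩
    | tmul a b =>
      obtain ⟨r, s, hs, rfl⟩ := IsFractionRing.div_surjective (A := A) a
      have hs0 := nonZeroDivisors.ne_zero hs
      have : algebraMap A K s ≠ 0 := by simpa using hs0
      refine ⟨s, hs0, r ⊗ₜ b, ?_⟩
      rw [TensorProduct.smul_tmul', Algebra.smul_def, mul_div_cancel₀ _ this]
      rfl
    | add x y hx hy =>
      obtain ⟨s, hs, x', hx⟩ := hx
      obtain ⟨t, ht, y', hy⟩ := hy
      refine ⟨s * t, mul_ne_zero hs ht, t • x' + s • y', ?_⟩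
      rw [map_add, map_smul, map_smul, hx, hy, smul_add, smul_smul, smul_smul, mul_comm t s]
  have hsm : ∀ (s : A) (x : K ⊗[k] F), s ≠ 0 → s • x = 0 → x = 0 := by
    intro s x hs h
    have hs' : algebraMap A K s ≠ 0 := by simpa using hs
    rw [← algebraMap_smul K s x] at h
    exact (smul_eq_zero_iff_right hs').1 h
  have hnt : Nontrivial (K ⊗[k] F) := hφ.nontrivial
  have : NoZeroDivisors (K ⊗[k] F) := by
    refine ⟨fun {x y} hxy => ?_⟩
    obtain ⟨s, hs, x', hx⟩ := key x
    obtain ⟨t, ht, y', hy⟩ := key y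
    have : φ (x' * y') = 0 := by
      rw [map_mul, hx, hy, smul_mul_smul_comm, hxy, smul_zero]
    rcases mul_eq_zero.1 (hφ (this.trans (map_zero φ).symm)) with h | h
    · left; exact hsm s x hs (by rw [← hx, h, map_zero])
    · right; exact hsm t y ht (by rw [← hy, h, map_zero])
  have : IsDomain (K ⊗[k] F) := NoZeroDivisors.to_isDomain _
  have : Algebra.IsIntegral k F := inferInstance
  exact isField_of_isIntegral_of_isField' (R := K) (Field.toIsField K)

theorem isReduced_Spec_of_smooth {k : Type u} [Field k] {R : CommRingCat.{u}}
    (f : Spec R ⟶ Spec (.of k)) [h : Smooth f] : AlgebraicGeometry.IsReduced (Spec R) := by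
  obtain ⟨φ, rfl⟩ := Spec.map_surjective f
  rw [HasRingHomProperty.Spec_iff (P := @Smooth)] at h
  algebraize [φ.hom]
  exact (affine_isReduced_iff R).2 (isReduced_of_smooth k R)

theorem isReduced_scheme_of_smooth {k : Type u} [Field k] {X : Scheme.{u}}
    (f : X ⟶ Spec (.of k)) [Smooth f] : AlgebraicGeometry.IsReduced X := by
  apply +allowSynthFailures @IsReduced.of_openCover (𝒰 := X.affineCover)
  intro i
  have : Smooth (X.affineCover.f i) := inferInstance
  exact isReduced_Spec_of_smooth (h := smooth_comp (X.affineCover.f i) f)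

theorem isDomain_tensorProduct {k F : Type u} {R : CommRingCat.{u}} [Field k] [Field F] [Algebra k F] [Algebra k R]
    [Algebra.Smooth k R]
    [GeometricallyIrreducible (Spec.map (CommRingCat.ofHom (algebraMap k R)))] :
    IsDomain (R ⊗[k] F) := by
  have h1 : IrreducibleSpace ↥(pullback (Spec.map (CommRingCat.ofHom (algebraMap k R)))
    (Spec.map (CommRingCat.ofHom (algebraMap k F)))) := 
    GeometricallyIrreducible.geometrically_irreducibleSpace _ _ _ (.of_hasPullback _ _)
  have h2 : IrreducibleSpace (PrimeSpectrum (R ⊗[k] F)) :=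
    (pullbackSpecIso k R F).hom.homeomorph.irreducibleSpace_iff.1 h1
  have : Algebra.Smooth F (F ⊗[k] R) := inferInstance
  have h3 : _root_.IsReduced (F ⊗[k] R) := isReduced_of_smooth F _
  have h4 : _root_.IsReduced (R ⊗[k] F) := 
    isReduced_of_injective (Algebra.TensorProduct.comm k R F) (AlgEquiv.injective _)
  rw [PrimeSpectrum.irreducibleSpace_iff_isPrime_nilradical, nilradical_eq_zero] at h2
  exact (IsDomain.of_bot_isPrime _)

/-! ### Function fields -/

theorem isIntegral_of_smooth {k : Type u} [Field k] {X : Scheme.{u}} (f : X ⟶ Spec (.of k))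
    [Smooth f] [GeometricallyIrreducible f] : AlgebraicGeometry.IsIntegral X := by
  have := isReduced_scheme_of_smooth f
  have : IrreducibleSpace X := GeometricallyIrreducible.irreducibleSpace_of_subsingleton f
  exact isIntegral_of_irreducibleSpace_of_isReduced X

noncomputable section

section FunctionField

variable {k : Type u} [Field k] {X : Scheme.{u}} (f : X ⟶ Spec (.of k))
  [Smooth f] [GeometricallyIrreducible f]

/-- The function field `k(X)` of a smooth, geometrically irreducible `k`-scheme `f : X ⟶ Spec k`.
The structure morphism is an argument because `k(X)` is to carry a structure of `k`-algebra. -/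
def FunctionField : Type u :=
  haveI := isIntegral_of_smooth f
  X.functionField

instance : Field (FunctionField f) :=
  haveI := isIntegral_of_smooth f
  inferInstanceAs (Field X.functionField)

/-- The embedding of the constants `k → Γ(X, ⊤) → k(X)`. -/
def constants : k →+* FunctionField f :=
  haveI := isIntegral_of_smooth f
  ((Scheme.ΓSpecIso (.of k)).inv ≫ f.appTop ≫ X.presheaf.germ ⊤ (genericPoint X) trivial).hom

instance : Algebra k (FunctionField f) := (constants f).toAlgebra

/-- `k(X) ⊗[k] F` is a field for every algebraic extension `F` of `k`: it is a domain because `X` is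
smooth and geometrically irreducible. -/
theorem isField_tensor_functionField (F : Type u) [Field F] [Algebra k F] [Algebra.IsAlgebraic k F] :
    IsField (FunctionField f ⊗[k] F) := by
  have := isIntegral_of_smooth f
  obtain ⟨U, hU, hxU⟩ := X.isBasis_affineOpens.exists_subset_of_mem_open
    (Set.mem_univ (genericPoint X)) isOpen_univ
  obtain ⟨U, hU', rfl⟩ := hU
  replace hU' : IsAffineOpen U := hU'
  have hne : Nonempty U := ⟨⟨_, hxU.1⟩⟩
  let φ : CommRingCat.of k ⟶ Γ(X, U) :=
    (Scheme.ΓSpecIso (.of k)).inv ≫ f.appTop ≫ X.presheaf.map (homOfLE le_top).op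
  have hφ : hU'.fromSpec ≫ f = Spec.map φ := by
    have h1 : f = X.toSpecΓ ≫ Spec.map ((Scheme.ΓSpecIso (.of k)).inv ≫ f.appTop) := by
      rw [Spec.map_comp, ← Scheme.toSpecΓ_naturality_assoc, ← SpecMap_ΓSpecIso_hom,
        ← Spec.map_comp, Iso.inv_hom_id, Spec.map_id, Category.comp_id]
    rw [h1, ← Category.assoc, hU'.fromSpec_toSpecΓ, ← Spec.map_comp, Category.assoc]
  have hs : Smooth (hU'.fromSpec ≫ f) := inferInstance
  have hsurj : Surjective (hU'.fromSpec ≫ f) := by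
    have : Nonempty (Spec Γ(X, U)) := ⟨hU'.isoSpec.hom hne.some⟩
    exact ⟨fun x => ⟨this.some, Subsingleton.elim _ _⟩⟩
  have hg : GeometricallyIrreducible (hU'.fromSpec ≫ f) := inferInstance
  rw [hφ] at hs hg
  rw [HasRingHomProperty.Spec_iff (P := @Smooth)] at hs
  algebraize [φ.hom]
  have := isDomain_tensorProduct (k := k) (F := F) (R := Γ(X, U))
  let _ : Algebra Γ(X, U) (FunctionField f) := inferInstanceAs (Algebra Γ(X, U) X.functionField)
  have : IsFractionRing Γ(X, U) (FunctionField f) :=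
    functionField_isFractionRing_of_isAffineOpen X U hU'
  have : IsScalarTower k Γ(X, U) (FunctionField f) := by
    refine IsScalarTower.of_algebraMap_eq' ?_
    change constants f = (X.germToFunctionField U).hom.comp φ.hom
    rw [← CommRingCat.hom_comp]
    simp only [φ, Category.assoc, constants]
    rw [X.presheaf.germ_res]
  exact isField_tensorProduct k Γ(X, U) (FunctionField f) F

variable (F : Type u) [Field F] [Algebra k F] [IsSepClosure k F]

/-- The field `k̄(X) = k(X) ⊗[k] k̄`, where `F = k̄` is a separable closure of `k`. -/
def GeomFunctionField : Type u := FunctionField f ⊗[k] F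

instance : Field (GeomFunctionField f F) :=
  (isField_tensor_functionField f F).toField

instance : Algebra (FunctionField f) (GeomFunctionField f F) :=
  inferInstanceAs (Algebra (FunctionField f) (FunctionField f ⊗[k] F))

instance : Algebra k (GeomFunctionField f F) :=
  inferInstanceAs (Algebra k (FunctionField f ⊗[k] F))

instance : Algebra F (GeomFunctionField f F) :=
  (Algebra.TensorProduct.includeRight :
    F →ₐ[k] FunctionField f ⊗[k] F).toRingHom.toAlgebra

instance : IsScalarTower k (FunctionField f) (GeomFunctionField f F) :=
  inferInstanceAs (IsScalarTower k (FunctionField f) (FunctionField f ⊗[k] F))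

instance : IsScalarTower k F (GeomFunctionField f F) :=
  IsScalarTower.of_algebraMap_eq' (Algebra.TensorProduct.includeRight :
    F →ₐ[k] FunctionField f ⊗[k] F).comp_algebraMap.symm

/-- The action of `Gal(k̄/k)` on `k̄(X) = k(X) ⊗[k] k̄` through the second factor. -/
def galAction : Gal(F/k) →* Gal(GeomFunctionField f F/FunctionField f) where
  toFun σ := (Algebra.TensorProduct.congr AlgEquiv.refl σ :
    FunctionField f ⊗[k] F ≃ₐ[FunctionField f]
      FunctionField f ⊗[k] F)
  map_one' := by
    ext x
    exact congrArg (fun g => g x) (Algebra.TensorProduct.congr_refl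
      (R := k) (S := FunctionField f) (A := FunctionField f) (B := F))
  map_mul' σ τ := by
    ext x
    exact congrArg (fun g => g x) (Algebra.TensorProduct.congr_trans
      (R := k) (S := FunctionField f) (AlgEquiv.refl : FunctionField f ≃ₐ[FunctionField f] _)
      AlgEquiv.refl τ σ)

theorem galAction_tmul (σ : Gal(F/k)) (a : FunctionField f)
    (b : F) :
    galAction f F σ (a ⊗ₜ[k] b : FunctionField f ⊗[k] F) =
      (a ⊗ₜ[k] σ b : FunctionField f ⊗[k] F) := rfl

theorem galAction_algebraMap (σ : Gal(F/k)) (b : F) :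
    galAction f F σ (algebraMap F (GeomFunctionField f F) b) =
      algebraMap F (GeomFunctionField f F) (σ b) := rfl

theorem exists_open_galAction_eq (x : GeomFunctionField f F) :
    ∃ U : Subgroup Gal(F/k), IsOpen (U : Set Gal(F/k)) ∧
      ∀ σ ∈ U, galAction f F σ x = x := by
  change FunctionField f ⊗[k] F at x
  induction x with
  | zero => exact ⟨⊤, isOpen_univ, fun σ _ => map_zero (galAction f F σ)⟩
  | tmul a b =>
    have hb : IsIntegral k b := Algebra.IsIntegral.isIntegral b
    have := IntermediateField.adjoin.finiteDimensional hb
    refine ⟨_, IntermediateField.fixingSubgroup_isOpen (IntermediateField.adjoin k {b}), ?_⟩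
    intro σ hσ
    rw [galAction_tmul]
    congr 1
    exact (IntermediateField.mem_fixingSubgroup_iff _ _).1 hσ b
      (IntermediateField.mem_adjoin_simple_self k b)
  | add x y hx hy =>
    obtain ⟨U, hU, hx⟩ := hx
    obtain ⟨V, hV, hy⟩ := hy
    refine ⟨U ⊓ V, hU.inter hV, fun σ hσ => ?_⟩
    exact (map_add (galAction f F σ) _ _).trans (congrArg₂ _ (hx σ hσ.1) (hy σ hσ.2))

end FunctionField

/-! ### Discrete modules and their extensions -/

section Ext

variable (G : Type u) [Group G] [TopologicalSpace G]

/-- An action of a topological group `G` by automorphisms on a commutative group `A`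
(written multiplicatively) makes `A` a discrete `G`-module if all stabilizers are open. -/
class IsDiscreteModule (A : Type u) [CommGroup A] [MulDistribMulAction G A] : Prop where
  isOpen_stabilizer : ∀ a : A, IsOpen (MulAction.stabilizer G a : Set G)

variable (A B : Type u) [CommGroup A] [MulDistribMulAction G A]
  [CommGroup B] [MulDistribMulAction G B]

/-- An extension `1 → B → E → A → 1` of discrete `G`-modules. -/
structure ModuleExtension where
  /-- the middle term -/
  E : Type u
  [commGroup : CommGroup E]
  [action : MulDistribMulAction G E]
  [isDiscrete : IsDiscreteModule G E]
  /-- the inclusion -/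
  incl : B →* E
  /-- the projection -/
  proj : E →* A
  incl_smul : ∀ (g : G) (b : B), incl (g • b) = g • incl b
  proj_smul : ∀ (g : G) (e : E), proj (g • e) = g • proj e
  incl_injective : Function.Injective incl
  range_eq_ker : incl.range = proj.ker
  proj_surjective : Function.Surjective proj

attribute [instance] ModuleExtension.commGroup ModuleExtension.action ModuleExtension.isDiscrete

/-- Two extensions of `A` by `B` are equivalent if there is a `G`-equivariant isomorphism of the
middle terms that is compatible with the inclusions of `B` and the projections to `A`. -/
instance ModuleExtension.setoid : Setoid (ModuleExtension G A B) where
  r S T := ∃ φ : S.E ≃* T.E, (∀ (g : G) (e : S.E), φ (g • e) = g • φ e) ∧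
    (∀ b, φ (S.incl b) = T.incl b) ∧ ∀ e, T.proj (φ e) = S.proj e
  iseqv :=
    { refl := fun S => ⟨MulEquiv.refl _, fun _ _ => rfl, fun _ => rfl, fun _ => rfl⟩
      symm := by
        rintro S T ⟨φ, h1, h2, h3⟩
        refine ⟨φ.symm, fun g e => ?_, fun b => ?_, fun e => ?_⟩
        · rw [MulEquiv.symm_apply_eq, h1, MulEquiv.apply_symm_apply]
        · rw [MulEquiv.symm_apply_eq, h2]
        · rw [← h3, MulEquiv.apply_symm_apply]
      trans := by
        rintro S T U ⟨φ, h1, h2, h3⟩ ⟨ψ, k1, k2, k3⟩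
        exact ⟨φ.trans ψ, fun g e => by simp [h1, k1], fun b => by simp [h2, k2],
          fun e => by simp [h3, k3]⟩ }

/-- `Ext¹` of discrete `G`-modules, as the set of equivalence classes of extensions. -/
def Ext1 : Type (u + 1) := Quotient (ModuleExtension.setoid G A B)

variable [IsDiscreteModule G A] [IsDiscreteModule G B]

instance : IsDiscreteModule G (B × A) where
  isOpen_stabilizer x := by
    have : (MulAction.stabilizer G x : Set G) =
        (MulAction.stabilizer G x.1 : Set G) ∩ (MulAction.stabilizer G x.2 : Set G) := by
      ext g
      simp [MulAction.mem_stabilizer_iff, Prod.ext_iff]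
    rw [this]
    exact (IsDiscreteModule.isOpen_stabilizer x.1).inter (IsDiscreteModule.isOpen_stabilizer x.2)

/-- The split extension `1 → B → B × A → A → 1`. -/
def ModuleExtension.split : ModuleExtension G A B where
  E := B × A
  incl := MonoidHom.inl B A
  proj := MonoidHom.snd B A
  incl_smul g b := Prod.ext rfl (smul_one g).symm
  proj_smul _ _ := rfl
  incl_injective := fun a b h => congrArg Prod.fst h
  range_eq_ker := by
    ext x
    simp only [MonoidHom.mem_range, MonoidHom.mem_ker]
    exact ⟨fun ⟨b, hb⟩ => hb ▸ rfl, fun h => ⟨x.1, Prod.ext rfl h.symm⟩⟩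
  proj_surjective := fun a => ⟨(1, a), rfl⟩

/-- The zero of `Ext¹` is the class of the split extension. -/
instance : Zero (Ext1 G A B) := ⟨Quotient.mk _ (ModuleExtension.split G A B)⟩

end Ext

/-! ### The elementary obstruction -/

section ElementaryObstruction

variable {k : Type u} [Field k] {X : Scheme.{u}} (f : X ⟶ Spec (.of k))
  [Smooth f] [GeometricallyIrreducible f]
  (F : Type u) [Field F] [Algebra k F] [IsSepClosure k F]

instance : MulDistribMulAction Gal(F/k) (GeomFunctionField f F)ˣ :=
  MulDistribMulAction.compHom _ (galAction f F)

/-- The subgroup of constants `k̄ˣ` in `k̄(X)ˣ`. -/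
abbrev constantUnits : Subgroup (GeomFunctionField f F)ˣ :=
  (Units.map (algebraMap F (GeomFunctionField f F)).toMonoidHom).range

theorem smul_map_algebraMap (σ : Gal(F/k)) (b : Fˣ) :
    σ • (Units.map (algebraMap F (GeomFunctionField f F)).toMonoidHom b) =
      Units.map (algebraMap F (GeomFunctionField f F)).toMonoidHom (σ • b) :=
  Units.ext (galAction_algebraMap f F σ b)

theorem constantUnits_le_comap (σ : Gal(F/k)) :
    constantUnits f F ≤
      (constantUnits f F).comap (MulDistribMulAction.toMonoidHom (GeomFunctionField f F)ˣ σ) := by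
  rintro _ ⟨b, rfl⟩
  exact ⟨σ • b, (smul_map_algebraMap f F σ b).symm⟩

/-- The action of `Gal(k̄/k)` on `k̄(X)ˣ / k̄ˣ` induced by that on `k̄(X)ˣ`. -/
instance : MulDistribMulAction Gal(F/k)
    ((GeomFunctionField f F)ˣ ⧸ constantUnits f F) where
  smul σ := QuotientGroup.map _ _ (MulDistribMulAction.toMonoidHom (GeomFunctionField f F)ˣ σ)
    (constantUnits_le_comap f F σ)
  one_smul x := by
    induction x using QuotientGroup.induction_on with
    | H x => exact congrArg (QuotientGroup.mk (s := constantUnits f F)) (one_smul _ x)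
  mul_smul σ τ x := by
    induction x using QuotientGroup.induction_on with
    | H x => exact congrArg (QuotientGroup.mk (s := constantUnits f F)) (mul_smul σ τ x)
  smul_mul σ x y := map_mul _ x y
  smul_one σ := map_one _

instance : IsDiscreteModule Gal(F/k) (GeomFunctionField f F)ˣ where
  isOpen_stabilizer x := by
    obtain ⟨U, hU, h⟩ := exists_open_galAction_eq f F (x : GeomFunctionField f F)
    exact Subgroup.isOpen_mono (fun σ hσ => Units.ext (h σ hσ)) hU

instance {k F : Type u} [Field k] [Field F] [Algebra k F] [Algebra.IsAlgebraic k F] :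
    IsDiscreteModule Gal(F/k) Fˣ where
  isOpen_stabilizer x := by
    have hx : IsIntegral k (x : F) := Algebra.IsIntegral.isIntegral _
    have := IntermediateField.adjoin.finiteDimensional hx
    refine Subgroup.isOpen_mono (fun σ hσ => Units.ext ?_)
      (IntermediateField.fixingSubgroup_isOpen (IntermediateField.adjoin k {(x : F)}))
    exact (IntermediateField.mem_fixingSubgroup_iff _ _).1 hσ x
      (IntermediateField.mem_adjoin_simple_self k (x : F))

instance : IsDiscreteModule Gal(F/k)
    ((GeomFunctionField f F)ˣ ⧸ constantUnits f F) where
  isOpen_stabilizer x := by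
    induction x using QuotientGroup.induction_on with
    | H x =>
      refine Subgroup.isOpen_mono (fun σ hσ => ?_)
        (IsDiscreteModule.isOpen_stabilizer (G := Gal(F/k)) x)
      exact congrArg (QuotientGroup.mk (s := constantUnits f F)) hσ

/-- The extension `1 → k̄ˣ → k̄(X)ˣ → k̄(X)ˣ / k̄ˣ → 1` of discrete `Gal(k̄/k)`-modules. -/
def unitsExtension : ModuleExtension Gal(F/k)
    ((GeomFunctionField f F)ˣ ⧸ constantUnits f F) Fˣ where
  E := (GeomFunctionField f F)ˣ
  incl := Units.map (algebraMap F (GeomFunctionField f F)).toMonoidHom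
  proj := QuotientGroup.mk' (constantUnits f F)
  incl_smul σ b := (smul_map_algebraMap f F σ b).symm
  proj_smul _ _ := rfl
  incl_injective :=
    Units.map_injective (algebraMap F (GeomFunctionField f F)).injective
  range_eq_ker := (QuotientGroup.ker_mk' _).symm
  proj_surjective := QuotientGroup.mk'_surjective _

/-- The elementary obstruction `ob(X)`: the class of the extension
`1 → k̄ˣ → k̄(X)ˣ → k̄(X)ˣ / k̄ˣ → 1` in `Ext¹` of discrete `Gal(k̄/k)`-modules. -/
def elementaryObstruction : Ext1 Gal(F/k)
    ((GeomFunctionField f F)ˣ ⧸ constantUnits f F) Fˣ :=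
  Quotient.mk _ (unitsExtension f F)

end ElementaryObstruction

/-! ### The abelian birational sequence -/

section Galois

/-- The maximal abelian subextension of `Ω / L`: the compositum of all
abelian Galois extensions of `L` contained in `Ω`. -/
def maximalAbelianSubextension (L Ω : Type*) [Field L] [Field Ω] [Algebra L Ω] :
    IntermediateField L Ω :=
  sSup {E | IsAbelianGalois L E}

/-- A sequence `N → E → G` of topological groups is a split short exact sequence if
`1 → N → E → G → 1` is exact and `E → G` has a section which is a continuous homomorphism. -/
structure IsSplitShortExact {N E G : Type*} [Group N] [Group E] [Group G]
    [TopologicalSpace E] [TopologicalSpace G] (i : N →* E) (p : E →* G) : Prop where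
  injective : Function.Injective i
  range_eq_ker : i.range = p.ker
  surjective : Function.Surjective p
  exists_section : ∃ s : G →* E, Continuous s ∧ ∀ g, p (s g) = g

variable {k : Type u} [Field k] {X : Scheme.{u}} (f : X ⟶ Spec (.of k))
  [Smooth f] [GeometricallyIrreducible f]
  (F : Type u) [Field F] [Algebra k F] [IsSepClosure k F]
  (Ω : Type u) [Field Ω] [Algebra (GeomFunctionField f F) Ω]

/-- The maximal abelian subextension `k̄(X)^ab` of `Ω / k̄(X)`, where `Ω` is a separable closure
of `k̄(X)`. -/
def GeomFunctionFieldAb : Type u := maximalAbelianSubextension (GeomFunctionField f F) Ω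

instance : Field (GeomFunctionFieldAb f F Ω) :=
  inferInstanceAs (Field (maximalAbelianSubextension (GeomFunctionField f F) Ω))

instance : Algebra (GeomFunctionField f F) (GeomFunctionFieldAb f F Ω) :=
  inferInstanceAs (Algebra (GeomFunctionField f F)
    (maximalAbelianSubextension (GeomFunctionField f F) Ω))

instance : Algebra (FunctionField f) (GeomFunctionFieldAb f F Ω) :=
  Algebra.compHom _ (algebraMap (FunctionField f) (GeomFunctionField f F))

instance : Algebra F (GeomFunctionFieldAb f F Ω) :=
  Algebra.compHom _ (algebraMap F (GeomFunctionField f F))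

instance : Algebra k (GeomFunctionFieldAb f F Ω) :=
  Algebra.compHom _ (algebraMap k (GeomFunctionField f F))

instance : IsScalarTower (FunctionField f) (GeomFunctionField f F) (GeomFunctionFieldAb f F Ω) :=
  IsScalarTower.of_algebraMap_eq' rfl

instance : IsScalarTower F (GeomFunctionField f F) (GeomFunctionFieldAb f F Ω) :=
  IsScalarTower.of_algebraMap_eq' rfl

instance : IsScalarTower k (GeomFunctionField f F) (GeomFunctionFieldAb f F Ω) :=
  IsScalarTower.of_algebraMap_eq' rfl

instance : IsScalarTower k (FunctionField f) (GeomFunctionFieldAb f F Ω) :=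
  IsScalarTower.to₁₂₄ k (FunctionField f) (GeomFunctionField f F) (GeomFunctionFieldAb f F Ω)

instance : IsScalarTower k F (GeomFunctionFieldAb f F Ω) :=
  IsScalarTower.to₁₂₄ k F (GeomFunctionField f F) (GeomFunctionFieldAb f F Ω)

/-- The inclusion of `Gal(k̄(X)^ab / k̄(X))` in `Gal(k̄(X)^ab / k(X))`. -/
def abInclusion : Gal(GeomFunctionFieldAb f F Ω/GeomFunctionField f F) →*
    Gal(GeomFunctionFieldAb f F Ω/FunctionField f) :=
  AlgEquiv.restrictScalarsHom (FunctionField f)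

/-- The restriction of automorphisms `Gal(k̄(X)^ab / k(X)) → Gal(k̄ / k)`. -/
def abProjection : Gal(GeomFunctionFieldAb f F Ω/FunctionField f) →* Gal(F/k) :=
  (AlgEquiv.restrictNormalHom F).comp (AlgEquiv.restrictScalarsHom k)

end Galois

end

end BirationalSections

/-! Write `K = k(X)`, `L = k̄(X)`, `A = L^ab`, `F = k̄`, and let `p` be the characteristic exponent.
If the class of the extension is zero, the splitting is a `G_k`-equivariant retraction `r : Lˣ →
Fˣ`. The section of `π : Gal(A/K) → G_k` is obtained from `r` in two steps, one away from `p` and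
one at `p`.

Away from `p`: let `M ⊆ Aˣ` be the group of units with a power in `L` of exponent invertible in `F`.
The map `r` extends to `R : M → Fˣ`, but not equivariantly. Let `H₁` be the closed subgroup of those
`g` that commute with `R`. For arbitrary `g`, the quotient of the `g`-conjugate of `R` by `R` is
trivial on `Lˣ`, so by Kummer duality (`exists_gal_smul_eq`) it comes from an element of `Gal(A/L)`.
Correcting `g` by that element lands in `H₁`, so `H₁` surjects onto `G_k`. An element `g` of `H₁ ∩
Gal(A/L)` multiplies `x ∈ M` by a constant, which `R` must send to `1`. As `R` is the identity on
constants, `g` fixes `M`, and Kummer theory (`exists_pow_apply_eq`) makes it pro-`p`.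

At `p`: when `p` is prime, `G_k` has `p`-cohomological dimension at most one, because Artin–Schreier
makes `F → F` surjective with kernel the prime field. Concretely,
`exists_subgroup_of_elementary_kernel` solves embedding problems with elementary abelian `p`-kernel.
A minimal closed subgroup of `H₁` surjecting onto `G_k` therefore has trivial kernel, since
otherwise it would contain a smaller one. The inverse of its projection to `G_k` is the section.
When `p = 1`, the kernel of `H₁ → G_k` is already trivial. -/

open scoped TensorProduct

namespace BirationalSections

/-! ### Embedding problems with elementary abelian `p`-kernel. -/

section EmbeddingProblem

/-- An open normal subgroup of a Galois group is the fixing subgroup of a finite Galois extension. -/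
theorem exists_isGalois_fixingSubgroup_eq {k F : Type*} [Field k] [Field F] [Algebra k F]
    [IsGalois k F] (P : Subgroup Gal(F/k)) [hn : P.Normal] (hP : IsOpen (P : Set Gal(F/k))) :
    ∃ E : IntermediateField k F, FiniteDimensional k E ∧ IsGalois k E ∧ E.fixingSubgroup = P := by
  let P' : ClosedSubgroup Gal(F/k) := ⟨P, P.isClosed_of_isOpen hP⟩
  have h : (IntermediateField.fixedField P).fixingSubgroup = P :=
    InfiniteGalois.fixingSubgroup_fixedField P'
  have := (InfiniteGalois.isOpen_and_normal_iff_finite_and_isGalois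
    (IntermediateField.fixedField P)).1 (by rw [h]; exact ⟨hP, hn⟩)
  exact ⟨_, this.1, this.2, h⟩

theorem exists_sum_eq_one (k E : Type*) [Field k] [Field E] [Algebra k E] [FiniteDimensional k E]
    [IsGalois k E] : ∃ t : E, ∑ σ : Gal(E/k), σ t = 1 := by
  obtain ⟨t, ht⟩ := Algebra.trace_surjective k E 1
  exact ⟨t, by rw [← trace_eq_sum_automorphisms, ht, map_one]⟩

/-- `x ↦ x ^ p - x` as a linear map over the prime field. -/
noncomputable def artinSchreier (p : ℕ) [Fact p.Prime] (F : Type*) [Field F] [CharP F p]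
    [Module (ZMod p) F] : F →ₗ[ZMod p] F :=
  AddMonoidHom.toZModLinearMap p ((frobenius F p).toAddMonoidHom - AddMonoidHom.id F)

theorem artinSchreier_apply (p : ℕ) [Fact p.Prime] (F : Type*) [Field F] [CharP F p]
    [Module (ZMod p) F] (x : F) : artinSchreier p F x = x ^ p - x := rfl

/-- The polynomial `X ^ p - X - c` is separable, its derivative being `-1`. -/
theorem artinSchreier_surjective (p : ℕ) [Fact p.Prime] (F : Type*) [Field F] [CharP F p]
    [Module (ZMod p) F] [IsSepClosed F] : Function.Surjective (artinSchreier p F) := by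
  intro c
  obtain ⟨x, hx⟩ := IsSepClosed.exists_root_C_mul_X_pow_add_C_mul_X_add_C (n := p) (1 : F) (-1) (-c)
    (CharP.cast_eq_zero F p) (Fact.out : p.Prime).two_le (by simp)
  exact ⟨x, by rw [artinSchreier_apply]; linear_combination hx⟩

/-- The prime field already supplies `p` roots of `X ^ p - X`, which leaves no room for another. -/
theorem artinSchreier_exact (p : ℕ) [Fact p.Prime] (F : Type*) [Field F] [CharP F p]
    [Algebra (ZMod p) F] :
    Function.Exact (Algebra.linearMap (ZMod p) F) (artinSchreier p F) := by
  classical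
  intro x
  rw [artinSchreier_apply]
  constructor
  · intro h
    have hp := (Fact.out : p.Prime)
    let q : Polynomial F := Polynomial.X ^ p - Polynomial.X
    have hq0 : q ≠ 0 := FiniteField.X_pow_card_sub_X_ne_zero F hp.one_lt
    have hdeg : q.natDegree = p := FiniteField.X_pow_card_sub_X_natDegree_eq F hp.one_lt
    by_contra hx
    have hsub : insert x (Finset.univ.image (algebraMap (ZMod p) F)) ⊆ q.roots.toFinset := by
      intro y hy
      rw [Multiset.mem_toFinset, Polynomial.mem_roots hq0, Polynomial.IsRoot.def]
      rw [Finset.mem_insert, Finset.mem_image] at hy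
      rcases hy with rfl | ⟨a, -, rfl⟩
      · simpa [q] using h
      · simp [q, ← map_pow, ZMod.pow_card]
    have hcard := Finset.card_le_card hsub
    rw [Finset.card_insert_of_notMem (by simpa using hx),
      Finset.card_image_of_injective _ (algebraMap (ZMod p) F).injective, Finset.card_univ,
      ZMod.card] at hcard
    have := (Multiset.toFinset_card_le _).trans (Polynomial.card_roots' q)
    omega
  · rintro ⟨a, rfl⟩
    simp [← map_pow, ZMod.pow_card]

variable {H : Type*} [Group H] [TopologicalSpace H] [IsTopologicalGroup H] [CompactSpace H]

theorem isOpen_map_of_surjective {G : Type*} [Group G] [TopologicalSpace G] [T2Space G]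
    (π : H →* G) (hπ : Continuous π) (hs : Function.Surjective π) {O : Subgroup H}
    (hO : IsOpen (O : Set H)) : IsOpen (O.map π : Set G) :=
  (MonoidHom.isOpenQuotientMap_of_isQuotientMap
    (hπ.isClosedMap.isQuotientMap hπ hs)).isOpenMap _ hO

variable {k F : Type*} [Field k] [Field F] [Algebra k F] [IsSepClosure k F]

open Topology in
/-- The Galois group `Gal(F/k)` of a separable closure in characteristic `p` is projective with
respect to embedding problems whose kernel `A` is an elementary abelian `p`-group. -/
theorem exists_subgroup_of_elementary_kernel (p : ℕ) [Fact p.Prime] [CharP F p]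
    (π : H →* Gal(F/k)) (hπ : Continuous π) (hs : Function.Surjective π)
    (O : Subgroup H) [O.Normal] (hO : IsOpen (O : Set H))
    {A : Type*} [AddCommGroup A] [Module (ZMod p) A]
    (θ : H → A) (θ_mul : ∀ m n, π m = 1 → π n = 1 → θ (m * n) = θ m + θ n)
    (θ_surj : ∀ a, ∃ n, π n = 1 ∧ θ n = a)
    (act : H → A →ₗ[ZMod p] A)
    (θ_conj : ∀ h n, π n = 1 → θ (h * n * h⁻¹) = act h (θ n))
    (θ_O : ∀ n ∈ O, π n = 1 → θ n = 0) :
    ∃ H' : Subgroup H, IsOpen (H' : Set H) ∧ H'.map π = ⊤ ∧ ∀ n ∈ H', π n = 1 → θ n = 0 := by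
  have hF : IsSepClosed F := IsSepClosure.sep_closed k
  let _ : Algebra (ZMod p) F := ZMod.algebra F p
  have θ_one : θ 1 = 0 := θ_O 1 O.one_mem (map_one π)
  have θ_inv : ∀ n, π n = 1 → θ n⁻¹ = - θ n := fun n hn => by
    have := θ_mul n⁻¹ n (by rw [map_inv, hn, inv_one]) hn
    rw [inv_mul_cancel, θ_one] at this
    exact eq_neg_of_add_eq_zero_left this.symm
  have act_mul : ∀ g h a, act (g * h) a = act g (act h a) := fun g h a => by
    obtain ⟨n, hn, rfl⟩ := θ_surj a
    have h1 : π (h * n * h⁻¹) = 1 := by simp [hn]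
    rw [← θ_conj _ n hn, ← θ_conj h n hn, ← θ_conj g _ h1]
    congr 1; group
  have act_ker : ∀ n, π n = 1 → act n = LinearMap.id := fun n hn => by
    ext a
    obtain ⟨m, hm, rfl⟩ := θ_surj a
    rw [← θ_conj _ m hm, θ_mul _ _ (by simp [hm, hn]) (by simp [hn]), θ_mul _ _ hn hm, θ_inv n hn]
    simp
  have act_O : ∀ o ∈ O, act o = LinearMap.id := fun o ho => by
    ext a
    obtain ⟨m, hm, rfl⟩ := θ_surj a
    have h1 : o * m * o⁻¹ = (o * (m * o⁻¹ * m⁻¹)) * m := by group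
    have h2 : o * (m * o⁻¹ * m⁻¹) ∈ O :=
      O.mul_mem ho (Subgroup.Normal.conj_mem inferInstance _ (O.inv_mem ho) m)
    rw [← θ_conj _ m hm, h1, θ_mul _ _ (by simp [hm]) hm, θ_O _ h2 (by simp [hm]), zero_add]
    rfl
  -- the finite quotient `Gal(E/k)` and an element of trace one
  have hPn : (O.map π).Normal := Subgroup.Normal.map inferInstance π hs
  obtain ⟨E, hE, hEg, hEfix⟩ :=
    exists_isGalois_fixingSubgroup_eq (O.map π) (isOpen_map_of_surjective π hπ hs hO)
  obtain ⟨t, ht⟩ := exists_sum_eq_one k E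
  let res : H →* Gal(E/k) := (AlgEquiv.restrictNormalHom E).comp π
  have res_surj : Function.Surjective res := (AlgEquiv.restrictNormalHom_surjective F).comp hs
  have res_apply : ∀ h (x : E), π h (x : F) = (res h x : E) := fun h x =>
    (AlgEquiv.restrictNormal_commutes (π h) E x).symm
  have res_ker : ∀ h, res h = 1 → ∃ n, π n = 1 ∧ n⁻¹ * h ∈ O := fun h hh => by
    have h1 : π h ∈ (AlgEquiv.restrictNormalHom (F := k) (K₁ := F) E).ker := hh
    rw [IntermediateField.restrictNormalHom_ker, hEfix] at h1
    obtain ⟨o, ho, hoh⟩ := h1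
    exact ⟨h * o⁻¹, by simp [hoh], by simpa using ho⟩
  obtain ⟨ρ, hρ⟩ := res_surj.hasRightInverse
  have res_O : ∀ o ∈ O, res o = 1 := fun o ho => by
    have h1 : π o ∈ (AlgEquiv.restrictNormalHom (F := k) (K₁ := F) E).ker := by
      rw [IntermediateField.restrictNormalHom_ker, hEfix]; exact ⟨o, ho, rfl⟩
    exact h1
  have res_N : ∀ n, π n = 1 → res n = 1 := fun n hn => by simp [res, hn]
  -- With `N = ker π`, this factors `h * ρ q` as `n * ρ (res h * q) * o` with `n ∈ N` and `o ∈ O`.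
  -- The factor `n = ν h q` is unique modulo `N ∩ O`, so `θ (ν h q)` is well defined; it measures
  -- the failure of `ρ` to be equivariant.
  have key : ∀ h q, ∃ n, π n = 1 ∧ (ρ (res h * q))⁻¹ * n⁻¹ * h * ρ q ∈ O := fun h q => by
    obtain ⟨n, hn, hno⟩ := res_ker (h * ρ q * (ρ (res h * q))⁻¹) (by simp [hρ _])
    refine ⟨n, hn, ?_⟩
    have := Subgroup.Normal.conj_mem inferInstance _ hno (ρ (res h * q))⁻¹
    convert this using 1; group
  choose ν hν1 hν2 using key
  have hν : ∀ h q n, π n = 1 → (ρ (res h * q))⁻¹ * n⁻¹ * h * ρ q ∈ O → θ (ν h q) = θ n := by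
    intro h q n hn hno
    have h1 := O.mul_mem hno (O.inv_mem (hν2 h q))
    have h2 := Subgroup.Normal.conj_mem inferInstance _ h1 (ρ (res h * q))
    have h3 : n⁻¹ * ν h q ∈ O := by convert h2 using 1; group
    have h4 := θ_O _ h3 (by simp [hn, hν1])
    rw [θ_mul _ _ (by simp [hn]) (hν1 h q), θ_inv n hn] at h4
    exact (neg_add_eq_zero.1 h4).symm
  have θν_mul : ∀ g h q, θ (ν (g * h) q) = θ (ν g (res h * q)) + act g (θ (ν h q)) := by
    intro g h q
    rw [← θ_conj _ _ (hν1 h q), add_comm,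
      ← θ_mul _ _ (by simp [hν1]) (hν1 g _)]
    apply hν _ _ _ (by simp [hν1])
    have := O.mul_mem (hν2 g (res h * q)) (hν2 h q)
    rw [map_mul, mul_assoc (res g)]
    convert this using 1; group
  -- the semilinear action on `F ⊗ A`
  let T : H → F ⊗[ZMod p] A →ₗ[ZMod p] F ⊗[ZMod p] A := fun h =>
    TensorProduct.map (AddMonoidHom.toZModLinearMap p (π h : F →+ F)) (act h)
  have T_tmul : ∀ h x a, T h (x ⊗ₜ a) = π h x ⊗ₜ act h a := fun h x a => rfl
  have T_mul : ∀ g h v, T (g * h) v = T g (T h v) := fun g h v => by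
    induction v with
    | zero => simp
    | tmul x a => simp [T_tmul, act_mul]
    | add v w hv hw => simp only [map_add, hv, hw]
  have T_smul : ∀ h (x : F) v, T h (x • v) = π h x • T h v := fun h x v => by
    induction v with
    | zero => simp
    | tmul y a => simp [T_tmul, TensorProduct.smul_tmul']
    | add v w hv hw => simp only [map_add, smul_add, hv, hw]
  have T_ker : ∀ n, π n = 1 → ∀ v, T n v = v := fun n hn v => by
    induction v with
    | zero => simp
    | tmul x a => simp [T_tmul, hn, act_ker n hn]
    | add v w hv hw => simp only [map_add, hv, hw]
  have T_near : ∀ v, ∀ᶠ h in 𝓝 (1 : H), T h v = v := fun v => by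
    induction v with
    | zero => simp
    | tmul x a =>
      have h1 : ∀ᶠ σ in 𝓝 (1 : Gal(F/k)), σ x = x :=
        (stabilizer_isOpen_of_isIntegral (K := k) x).mem_nhds (one_mem _)
      rw [← map_one π] at h1
      filter_upwards [hπ.continuousAt.eventually h1, hO.mem_nhds O.one_mem] with h hx ho
      rw [T_tmul, hx, act_O h ho]; rfl
    | add v w hv hw =>
      filter_upwards [hv, hw] with h hv hw
      rw [map_add, hv, hw]
  let ψ : F ⊗[ZMod p] A →ₗ[ZMod p] F ⊗[ZMod p] A := LinearMap.rTensor A (artinSchreier p F)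
  have ψ_surj : Function.Surjective ψ := LinearMap.rTensor_surjective A (artinSchreier_surjective p F)
  have ψ_ker : ∀ v, ψ v = 0 → ∃ a : A, 1 ⊗ₜ a = v := fun v hv => by
    obtain ⟨y, rfl⟩ := (Module.Flat.rTensor_exact A (artinSchreier_exact p F) v).1 hv
    obtain ⟨a, rfl⟩ := (TensorProduct.lid (ZMod p) A).symm.surjective y
    exact ⟨a, by simp⟩
  have one_tmul_inj : ∀ a : A, (1 : F) ⊗ₜ[ZMod p] a = 0 → a = 0 := fun a ha => by
    have h1 := Module.Flat.rTensor_preserves_injective_linearMap (M := A)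
      (Algebra.linearMap (ZMod p) F) (algebraMap (ZMod p) F).injective
    have h2 : LinearMap.rTensor A (Algebra.linearMap (ZMod p) F)
      ((TensorProduct.lid (ZMod p) A).symm a) = 0 := by simpa using ha
    simpa using (map_eq_zero_iff _ h1).1 h2
  have ψ_T : ∀ h v, ψ (T h v) = T h (ψ v) := fun h v => by
    induction v with
    | zero => simp
    | tmul x a => simp [ψ, T_tmul, artinSchreier_apply]
    | add v w hv hw => simp only [map_add, hv, hw]
  -- the crossed homomorphism
  let β : H → F ⊗[ZMod p] A := fun h => ∑ q, ((res h * q) t : F) ⊗ₜ[ZMod p] θ (ν h q)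
  -- Weighting the values `θ (ν h q)` by the conjugates of `t` turns their cocycle relation in `q`
  -- into a genuine crossed homomorphism. Since `t` has trace one, it restricts to `1 ⊗ θ` on the
  -- kernel.
  have β_mul : ∀ g h, β (g * h) = β g + T g (β h) := fun g h => by
    simp only [β, θν_mul, TensorProduct.tmul_add, Finset.sum_add_distrib, map_sum, T_tmul]
    congr 1
    · rw [← Equiv.sum_comp (Equiv.mulLeft (res h)) fun q => ((res g * q) t : F) ⊗ₜ θ (ν g q)]
      refine Finset.sum_congr rfl fun q _ => ?_
      simp [mul_assoc]
    · refine Finset.sum_congr rfl fun q _ => ?_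
      rw [res_apply, map_mul, mul_assoc]; rfl
  have sum_t : ∑ q : Gal(E/k), (q t : F) = 1 := by
    rw [← IntermediateField.coe_sum, ht]; rfl
  have β_ker : ∀ n, π n = 1 → β n = 1 ⊗ₜ θ n := fun n hn => by
    have : ∀ q, θ (ν n q) = θ n := fun q => hν _ _ _ hn (by simp [res_N n hn])
    simp only [β, this, res_N n hn, one_mul, ← TensorProduct.sum_tmul, sum_t]
  have β_O : ∀ o ∈ O, β o = 0 := fun o ho => by
    have : ∀ q, θ (ν o q) = 0 := fun q => by
      rw [← θ_one]
      refine hν _ _ _ (map_one π) ?_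
      have := Subgroup.Normal.conj_mem inferInstance _ ho (ρ q)⁻¹
      simpa [res_O o ho, mul_assoc] using this
    simp [β, this]
  -- `ψ ∘ β` is inflated from `Gal(E/k)`, hence principal
  let γ : H → F ⊗[ZMod p] A := fun h => ψ (β h)
  have γ_mul : ∀ g h, γ (g * h) = γ g + T g (γ h) := fun g h => by
    simp only [γ, β_mul, map_add, ψ_T]
  have γ_ker : ∀ n, π n = 1 → γ n = 0 := fun n hn => by
    simp [γ, β_ker n hn, ψ, artinSchreier_apply]
  have γ_O : ∀ o ∈ O, γ o = 0 := fun o ho => by simp [γ, β_O o ho]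
  -- As `γ` kills both `ker π` and `O`, it does not see the choice of `ρ` and descends to
  -- `Gal(E/k)`.
  have γ_ρ : ∀ h q, γ (h * ρ q) = γ (ρ (res h * q)) := fun h q => by
    have h1 : h * ρ q = ν h q * (ρ (res h * q) * ((ρ (res h * q))⁻¹ * (ν h q)⁻¹ * h * ρ q)) := by
      group
    rw [h1, γ_mul, γ_mul, γ_O _ (hν2 h q), γ_ker _ (hν1 h q), T_ker _ (hν1 h q)]
    simp
  -- Additive Hilbert 90: averaging `γ` against `t` exhibits it as the coboundary `h ↦ v - T h v`.
  let v : F ⊗[ZMod p] A := ∑ q, (q t : F) • γ (ρ q)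
  have T_v : ∀ h, T h v = v - γ h := fun h => by
    have h1 : ∀ q, T h ((q t : F) • γ (ρ q)) =
        ((res h * q) t : F) • γ (ρ (res h * q)) - ((res h * q) t : F) • γ h := fun q => by
      rw [T_smul, ← γ_ρ, γ_mul, smul_add, add_sub_cancel_left, res_apply]; rfl
    simp only [v, map_sum, h1, Finset.sum_sub_distrib, ← Finset.sum_smul]
    have e1 := Equiv.sum_comp (Equiv.mulLeft (res h)) (fun q => (q t : F) • γ (ρ q))
    have e2 := Equiv.sum_comp (Equiv.mulLeft (res h)) (fun q => (q t : F))
    simp only [Equiv.coe_mulLeft] at e1 e2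
    rw [e1, e2, sum_t, one_smul]
  obtain ⟨w, hw⟩ := ψ_surj v
  -- Correcting by the coboundary of an Artin–Schreier preimage of `v` makes `ψ ∘ β'` vanish. So
  -- `β'` takes values in `1 ⊗ A` and still restricts to `1 ⊗ θ` on the kernel; its zero set is the
  -- required subgroup.
  let β' : H → F ⊗[ZMod p] A := fun h => β h + T h w - w
  have β'_mul : ∀ g h, β' (g * h) = β' g + T g (β' h) := fun g h => by
    simp only [β', β_mul, T_mul, map_add, map_sub]; abel
  have β'_ker : ∀ n, π n = 1 → β' n = 1 ⊗ₜ θ n := fun n hn => by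
    simp [β', β_ker n hn, T_ker n hn]
  have β'_mem : ∀ h, ∃ a : A, 1 ⊗ₜ a = β' h := fun h => ψ_ker _ (by
    simp only [β', map_sub, map_add, ψ_T, hw, T_v]
    change γ h + _ - _ = _
    abel)
  have β'_one : β' 1 = 0 := by rw [β'_ker 1 (map_one π), θ_one, TensorProduct.tmul_zero]
  let H' : Subgroup H :=
    { carrier := {h | β' h = 0}
      one_mem' := β'_one
      mul_mem' := fun {g h} hg hh => by
        simp only [Set.mem_ofPred_eq] at hg hh ⊢
        rw [β'_mul, hg, hh, map_zero, add_zero]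
      inv_mem' := fun {h} hh => by
        simp only [Set.mem_ofPred_eq] at hh ⊢
        have := β'_mul h⁻¹ h
        rw [inv_mul_cancel, β'_one, hh, map_zero, add_zero] at this
        exact this.symm }
  refine ⟨H', H'.isOpen_of_mem_nhds (g := 1) ?_, ?_, fun n hn hn1 => ?_⟩
  · filter_upwards [T_near w, hO.mem_nhds O.one_mem] with h hh ho
    change β h + T h w - w = 0
    rw [hh, β_O h ho]; simp
  · rw [eq_top_iff]
    rintro g -
    obtain ⟨h, rfl⟩ := hs g
    obtain ⟨a, ha⟩ := β'_mem h
    obtain ⟨n, hn, rfl⟩ := θ_surj a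
    refine ⟨n⁻¹ * h, ?_, by simp [hn]⟩
    change β' _ = 0
    have hn' : π n⁻¹ = 1 := by simp [hn]
    rw [β'_mul, β'_ker _ hn', T_ker _ hn', ← ha, θ_inv n hn, TensorProduct.tmul_neg]
    simp
  · apply one_tmul_inj
    rw [← β'_ker n hn1]; exact hn

/-! ### Abelian pro-`p` kernels and minimal supplements. -/

open Topology

/-- The image `Q` of the kernel in a finite quotient of `H` where `n₀` survives is an abelian group
containing a nontrivial element of `p`-power order. Hence `Q / Q ^ p` is nontrivial, and the
embedding problem with this kernel yields a proper subgroup. -/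
theorem exists_proper_subgroup_of_pro_p_kernel
    {H : Type*} [Group H] [TopologicalSpace H] [IsTopologicalGroup H] [CompactSpace H] [T2Space H]
    [TotallyDisconnectedSpace H] (p : ℕ) [Fact p.Prime] [CharP F p]
    (π : H →* Gal(F/k)) (hπ : Continuous π) (hs : Function.Surjective π)
    (hcomm : ∀ m n, π m = 1 → π n = 1 → m * n = n * m)
    (hpro : ∀ n, π n = 1 → ∀ U ∈ 𝓝 (1 : H), ∃ j : ℕ, n ^ p ^ j ∈ U)
    (n₀ : H) (hn₀ : π n₀ = 1) (hn₀' : n₀ ≠ 1) :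
    ∃ H' : Subgroup H, IsOpen (H' : Set H) ∧ H'.map π = ⊤ ∧ H' ≠ ⊤ := by
  have hp := (Fact.out : p.Prime)
  obtain ⟨W, hW⟩ := ProfiniteGrp.exist_openNormalSubgroup_sub_open_nhds_of_one
    (isOpen_compl_singleton (x := n₀)) (by simpa using hn₀'.symm)
  have hWo : IsOpen ((W : Subgroup H) : Set H) := W.isOpen'
  have hfin : Finite (H ⧸ (W : Subgroup H)) := Subgroup.quotient_finite_of_isOpen _ hWo
  have hfi := Subgroup.finiteIndex_of_finite_quotient (H := (W : Subgroup H))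
  let _ : CommGroup π.ker :=
    { (inferInstance : Group π.ker) with
      mul_comm := fun m n => Subtype.ext (hcomm m n m.2 n.2) }
  let W' : Subgroup π.ker := (W : Subgroup H).subgroupOf π.ker
  let Q := π.ker ⧸ W'
  have : Finite Q := inferInstance
  let B := Q ⧸ (powMonoidHom p : Q →* Q).range
  let _ : Module (ZMod p) (Additive B) := AddCommGroup.zmodModule (G := Additive B) fun x => by
    obtain ⟨q, hq⟩ := QuotientGroup.mk_surjective x.toMul
    have : x.toMul ^ p = 1 := by
      rw [← hq, ← QuotientGroup.mk_pow]
      exact (QuotientGroup.eq_one_iff _).2 ⟨q, rfl⟩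
    exact this
  let cQ : H → Q →* Q := fun h => QuotientGroup.map W' W' (MulAut.conjNormal h).toMonoidHom
    fun x hx => by
      change h * x * h⁻¹ ∈ (W : Subgroup H)
      exact Subgroup.Normal.conj_mem (H := (W : Subgroup H)) inferInstance _ hx h
  let cB : H → B →* B := fun h => QuotientGroup.map _ _ (cQ h) (by
    rintro _ ⟨q, rfl⟩
    exact ⟨cQ h q, (map_pow (cQ h) q p).symm⟩)
  classical
  let θ : H → Additive B := fun h =>
    if hh : π h = 1 then Additive.ofMul (QuotientGroup.mk (QuotientGroup.mk ⟨h, hh⟩)) else 0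
  have θ_def : ∀ h (hh : π h = 1),
      θ h = Additive.ofMul (QuotientGroup.mk (QuotientGroup.mk ⟨h, hh⟩)) := fun h hh => dif_pos hh
  obtain ⟨H', h1, h2, h3⟩ := exists_subgroup_of_elementary_kernel p π hπ hs W hWo θ
    (fun m n hm hn => by
      rw [θ_def m hm, θ_def n hn, θ_def (m * n) (by simp [hm, hn])]; rfl)
    (fun a => by
      obtain ⟨q, hq⟩ := QuotientGroup.mk_surjective a.toMul
      obtain ⟨n, rfl⟩ := QuotientGroup.mk_surjective q
      exact ⟨n, n.2, by rw [θ_def n n.2]; exact hq⟩)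
    (fun h => AddMonoidHom.toZModLinearMap p (cB h).toAdditive)
    (fun h n hn => by
      rw [θ_def n hn, θ_def _ (by simp [hn])]; rfl)
    (fun n hnW hn => by
      rw [θ_def n hn]
      have : (QuotientGroup.mk ⟨n, hn⟩ : Q) = 1 := (QuotientGroup.eq_one_iff _).2 hnW
      rw [this]; rfl)
  refine ⟨H', h1, h2, ?_⟩
  rintro rfl
  have hsurj : Function.Surjective (powMonoidHom p : Q →* Q) := fun q => by
    obtain ⟨n, rfl⟩ := QuotientGroup.mk_surjective q
    have := h3 n trivial n.2
    rw [θ_def n n.2] at this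
    exact (QuotientGroup.eq_one_iff _).1 this
  have hinj := Finite.injective_iff_surjective.2 hsurj
  obtain ⟨j, hj⟩ := hpro n₀ hn₀ W (hWo.mem_nhds (one_mem _))
  have hpow : ∀ j : ℕ, ∀ q : Q, q ^ p ^ j = 1 → q = 1 := fun j => by
    induction j with
    | zero => simp
    | succ j ih =>
      intro q hq
      rw [pow_succ, pow_mul] at hq
      exact ih q (hinj (hq.trans (one_pow p).symm))
  have hq := hpow j (QuotientGroup.mk ⟨n₀, hn₀⟩) (by
    rw [← QuotientGroup.mk_pow]; exact (QuotientGroup.eq_one_iff _).2 hj)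
  have hmem : (⟨n₀, hn₀⟩ : π.ker) ∈ W' := (QuotientGroup.eq_one_iff _).1 hq
  exact hW hmem rfl

/-- Every closed subgroup that surjects onto `G` contains a minimal one. -/
theorem exists_minimal_closed_subgroup {E G : Type*} [Group E] [TopologicalSpace E]
    [CompactSpace E] [Group G] [TopologicalSpace G] [T1Space G]
    (π : E →* G) (hπ : Continuous π) (H₁ : Subgroup E) (hc : IsClosed (H₁ : Set E))
    (hs : H₁.map π = ⊤) :
    ∃ H ≤ H₁, IsClosed (H : Set E) ∧ H.map π = ⊤ ∧
      ∀ H' ≤ H, IsClosed (H' : Set E) → H'.map π = ⊤ → H' = H := by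
  let S : Set (Set E) :=
    {s | ∃ H : Subgroup E, (H : Set E) = s ∧ H ≤ H₁ ∧ IsClosed (H : Set E) ∧ H.map π = ⊤}
  obtain ⟨m, hm⟩ := zorn_superset S (by
    intro c hcS hchain
    rcases c.eq_empty_or_nonempty with rfl | hne
    · exact ⟨H₁, ⟨H₁, rfl, le_rfl, hc, hs⟩, by simp⟩
    refine ⟨⋂₀ c, ⟨sInf {H | (H : Set E) ∈ c}, ?_, ?_, ?_, ?_⟩,
      fun s hs => Set.sInter_subset_of_mem hs⟩
    · ext x
      simp only [SetLike.mem_coe, Subgroup.mem_sInf, Set.mem_sInter, Set.mem_ofPred_eq]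
      exact ⟨fun h s hs => by obtain ⟨H, rfl, -⟩ := hcS hs; exact h H hs, fun h H hH => h _ hH⟩
    · obtain ⟨s, hs⟩ := hne
      obtain ⟨H, rfl, hH, -⟩ := hcS hs
      exact fun x hx => hH (Subgroup.mem_sInf.1 hx H hs)
    · rw [Subgroup.coe_sInf]
      refine isClosed_biInter fun H hH => ?_
      obtain ⟨H', h1, -, h2, -⟩ := hcS hH
      exact h1 ▸ h2
    · rw [eq_top_iff]
      rintro g -
      have hcl : IsClosed (π ⁻¹' {g}) := isClosed_singleton.preimage hπ
      have hcne : Nonempty c := hne.to_subtype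
      -- The fibres over `g` of the members of the chain are nested, nonempty and compact, so they
      -- have a common point.
      obtain ⟨x, hx⟩ := IsCompact.nonempty_iInter_of_directed_nonempty_isCompact_isClosed
        (fun s : c => s.1 ∩ π ⁻¹' {g})
        (fun s t => by
          rcases hchain.total s.2 t.2 with h | h
          · exact ⟨s, subset_rfl, Set.inter_subset_inter_left _ h⟩
          · exact ⟨t, Set.inter_subset_inter_left _ h, subset_rfl⟩)
        (fun s => by
          obtain ⟨H, h1, -, -, h2⟩ := hcS s.2
          have : g ∈ H.map π := h2 ▸ trivial
          obtain ⟨x, hx, hxg⟩ := this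
          exact ⟨x, h1 ▸ hx, hxg⟩)
        (fun s => by
          obtain ⟨H, h1, -, h2, -⟩ := hcS s.2
          exact ((h1 ▸ h2).inter hcl).isCompact)
        (fun s => by
          obtain ⟨H, h1, -, h2, -⟩ := hcS s.2
          exact (h1 ▸ h2).inter hcl)
      rw [Set.mem_iInter] at hx
      refine ⟨x, ?_, (hx ⟨_, hne.some_mem⟩).2⟩
      simp only [SetLike.mem_coe, Subgroup.mem_sInf, Set.mem_ofPred_eq]
      exact fun H hH => (hx ⟨_, hH⟩).1)
  obtain ⟨H, rfl, h1, h2, h3⟩ := hm.prop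
  exact ⟨H, h1, h2, h3, fun H' hle hcl hsu => SetLike.coe_injective
    (hm.eq_of_subset ⟨H', rfl, hle.trans h1, hcl, hsu⟩ hle)⟩

/-- A continuous surjection of a profinite group onto the absolute Galois group of a field of
characteristic exponent `p` splits as soon as it does so up to an abelian pro-`p` kernel. -/
theorem exists_continuous_section_of_pro_p_kernel
    {E : Type*} [Group E] [TopologicalSpace E] [IsTopologicalGroup E] [CompactSpace E] [T2Space E]
    [TotallyDisconnectedSpace E] (p : ℕ) [hp : ExpChar F p]
    (π : E →* Gal(F/k)) (hπ : Continuous π) (H₁ : Subgroup E) (hc : IsClosed (H₁ : Set E))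
    (hs : H₁.map π = ⊤)
    (hcomm : ∀ m n, π m = 1 → π n = 1 → m * n = n * m)
    (hpro : ∀ n ∈ H₁, π n = 1 → ∀ U ∈ 𝓝 (1 : E), ∃ j : ℕ, n ^ p ^ j ∈ U) :
    ∃ s : Gal(F/k) →* E, Continuous s ∧ ∀ g, π (s g) = g := by
  obtain ⟨H, hle, hcl, hsu, hmin⟩ := exists_minimal_closed_subgroup π hπ H₁ hc hs
  have : CompactSpace H := isCompact_iff_compactSpace.1 hcl.isCompact
  let πH : H →* Gal(F/k) := π.comp H.subtype
  have hπH : Continuous πH := hπ.comp continuous_subtype_val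
  have hsH : Function.Surjective πH := fun g => by
    have : g ∈ H.map π := hsu ▸ trivial
    obtain ⟨x, hx, rfl⟩ := this
    exact ⟨⟨x, hx⟩, rfl⟩
  have hker : ∀ n : H, πH n = 1 → n = 1 := by
    intro n hn
    by_contra hne
    cases hp with
    -- Here `p = 1`, so `hpro` places `n` itself in every neighbourhood of `1`.
    | zero =>
      have hne' : (n : E) ≠ 1 := fun h => hne (Subtype.ext h)
      obtain ⟨j, hj⟩ := hpro n (hle n.2) hn {(n : E)}ᶜ (isOpen_compl_singleton.mem_nhds hne'.symm)
      simp at hj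
    | prime hprime =>
      have : Fact p.Prime := ⟨hprime⟩
      obtain ⟨H', ho, hsur, hnt⟩ := exists_proper_subgroup_of_pro_p_kernel p πH hπH hsH
        (fun a b ha hb => Subtype.ext (hcomm a b ha hb))
        (fun a ha U hU => by
          obtain ⟨V, hV, hVU⟩ := mem_nhds_subtype _ _ _ |>.1 hU
          obtain ⟨j, hj⟩ := hpro a (hle a.2) ha V hV
          exact ⟨j, hVU hj⟩) n hn hne
      -- An open subgroup of `H` is closed in `E`, so minimality forces `H'` to be all of `H`.
      have h1 := hmin (H'.map H.subtype) (Subgroup.map_subtype_le H')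
        (by
          rw [Subgroup.coe_map]
          exact hcl.isClosedEmbedding_subtypeVal.isClosedMap _ (H'.isClosed_of_isOpen ho))
        (by rw [Subgroup.map_map]; exact hsur)
      apply hnt
      rw [eq_top_iff]
      rintro x -
      have : (x : E) ∈ H'.map H.subtype := h1.ge x.2
      obtain ⟨y, hy, hyx⟩ := this
      have : y = x := Subtype.ext hyx
      exact this ▸ hy
  let e : H ≃* Gal(F/k) := MulEquiv.ofBijective πH ⟨(injective_iff_map_eq_one πH).2 hker, hsH⟩
  have he : Continuous e.symm :=
    (Continuous.homeoOfEquivCompactToT2 (f := e.toEquiv) hπH).symm.continuous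
  exact ⟨H.subtype.comp e.symm.toMonoidHom, continuous_subtype_val.comp he,
    fun g => e.apply_symm_apply g⟩

end EmbeddingProblem

/-! ### Kummer theory over a field containing a separably closed field. -/

section Kummer

/-- `X ^ n - c` is separable, so it splits in `F` and acquires no new roots in `B`. -/
theorem exists_algebraMap_eq_of_pow_eq {F B : Type*} [Field F] [IsSepClosed F] [Field B]
    [Algebra F B] {n : ℕ} (hn : (n : F) ≠ 0) {c : F} (hc : c ≠ 0) {x : B}
    (hx : x ^ n = algebraMap F B c) : ∃ z, algebraMap F B z = x := by
  have hsep := Polynomial.separable_X_pow_sub_C c hn hc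
  exact (IsSepClosed.splits_of_separable _ hsep).mem_range_of_isRoot hsep.ne_zero
    (i := algebraMap F B) (by simp [Polynomial.IsRoot, hx])

variable (F L A : Type*) [Field F] [Field L] [Field A] [Algebra L A]

/-- The units of `A` that have a power in `L`, with exponent invertible in `F`. -/
def kummerUnits : Subgroup Aˣ where
  carrier := {x | ∃ n : ℕ, (n : F) ≠ 0 ∧ ∃ y : L, algebraMap L A y = (x : A) ^ n}
  one_mem' := ⟨1, by simp, 1, by simp⟩
  mul_mem' := by
    rintro x x' ⟨n, hn, y, hy⟩ ⟨n', hn', y', hy'⟩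
    refine ⟨n * n', by simp [hn, hn'], y ^ n' * y' ^ n, ?_⟩
    rw [map_mul, map_pow, map_pow, hy, hy', Units.val_mul]; ring
  inv_mem' := by
    rintro x ⟨n, hn, y, hy⟩
    exact ⟨n, hn, y⁻¹, by rw [map_inv₀, hy]; simp⟩

variable {F L A}

/-- Homomorphisms into the units of a separably closed field extend to `kummerUnits`. -/
theorem exists_monoidHom_kummerUnits [IsSepClosed F] (r : Lˣ →* Fˣ) :
    ∃ R : kummerUnits F L A →* Fˣ, ∀ (x : kummerUnits F L A) (y : Lˣ),
      algebraMap L A y = ((x : Aˣ) : A) → R x = r y := by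
  -- `Fˣ` need not be divisible in characteristic `p`, so the extension is made into `Cˣ`, which is
  -- an injective abelian group.
  let C := AlgebraicClosure F
  let i : Lˣ →* kummerUnits F L A := (Units.map (algebraMap L A).toMonoidHom).codRestrict _
    fun y => ⟨1, by simp, y, by simp⟩
  have hi : Function.Injective i := fun y y' h => by
    have := congrArg (fun x : kummerUnits F L A => ((x : Aˣ) : A)) h
    exact Units.ext ((algebraMap L A).injective this)
  let ι : Fˣ →* Cˣ := Units.map (algebraMap F C).toMonoidHom
  have hι : Function.Injective ι := Units.map_injective (algebraMap F C).injective
  let _ : DivisibleBy (Additive Cˣ) ℕ := divisibleByOfSMulRightSurj _ _ fun {n} hn x => by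
    obtain ⟨z, hz⟩ := IsAlgClosed.exists_pow_nat_eq ((x.toMul : Cˣ) : C) (Nat.pos_of_ne_zero hn)
    have hz0 : z ≠ 0 := by
      rintro rfl
      rw [zero_pow hn] at hz
      exact x.toMul.ne_zero hz.symm
    exact ⟨Additive.ofMul (Units.mk0 z hz0), Units.ext hz⟩
  let _ : DivisibleBy (Additive Cˣ) ℤ := AddGroup.divisibleByIntOfDivisibleByNat _
  obtain ⟨h, hh⟩ := (Module.Baer.of_divisible (Additive Cˣ)).extension_property_addMonoidHom
    (i.toAdditive) hi (ι.comp r).toAdditive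
  let h' : kummerUnits F L A →* Cˣ := MonoidHom.toAdditive.symm h
  have hh' : ∀ y, h' (i y) = ι (r y) := fun y => DFunLike.congr_fun hh y
  -- Some power of `h' x`, with exponent invertible in `F`, lies in `Fˣ`; hence so does `h' x`.
  have hrange : ∀ x, h' x ∈ ι.range := fun x => by
    obtain ⟨n, hn, y, hy⟩ := x.2
    have hy0 : y ≠ 0 := by
      rintro rfl
      rw [map_zero] at hy
      exact pow_ne_zero n (x : Aˣ).ne_zero hy.symm
    have h1 : i (Units.mk0 y hy0) = x ^ n := Subtype.ext (Units.ext (by simpa [i] using hy))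
    have h2 := hh' (Units.mk0 y hy0)
    rw [h1, map_pow] at h2
    obtain ⟨z, hz⟩ := exists_algebraMap_eq_of_pow_eq hn (r (Units.mk0 y hy0)).ne_zero
      (x := ((h' x : Cˣ) : C)) ((Units.val_pow_eq_pow_val _ _).symm.trans (congrArg Units.val h2))
    have hz0 : z ≠ 0 := by
      rintro rfl
      rw [map_zero] at hz
      exact (h' x : Cˣ).ne_zero hz.symm
    exact ⟨Units.mk0 z hz0, Units.ext hz⟩
  refine ⟨(MonoidHom.ofInjective hι).symm.toMonoidHom.comp (h'.codRestrict _ hrange),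
    fun x y hxy => ?_⟩
  have hx : x = i y := Subtype.ext (Units.ext hxy.symm)
  change (MonoidHom.ofInjective hι).symm _ = _
  rw [MulEquiv.symm_apply_eq]
  exact Subtype.ext (hx ▸ hh' y)

variable [Algebra F A]

theorem exists_smul_eq_of_mem_kummerUnits [IsSepClosed F] (τ : Gal(A/L)) {x : Aˣ}
    (hx : x ∈ kummerUnits F L A) : ∃ z : F, algebraMap F A z = τ x / x := by
  obtain ⟨n, hn, y, hy⟩ := hx
  refine exists_algebraMap_eq_of_pow_eq hn one_ne_zero ?_
  rw [div_pow, ← map_pow, ← hy, τ.commutes, map_one, div_self]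
  rw [hy]
  exact pow_ne_zero _ x.ne_zero

variable [Algebra F L] [IsScalarTower F L A]

/-- **Kummer duality**: a homomorphism `kummerUnits F L A → Fˣ` that is trivial on the units of `L`
is given by the action of an element of the Galois group. -/
theorem exists_gal_smul_eq [IsSepClosed F] [IsGalois L A] (χ : kummerUnits F L A →* Fˣ)
    (hχ : ∀ (x : kummerUnits F L A) (y : L), algebraMap L A y = ((x : Aˣ) : A) → χ x = 1) :
    ∃ τ : Gal(A/L), ∀ x : kummerUnits F L A,
      τ ((x : Aˣ) : A) = algebraMap F A (χ x) * ((x : Aˣ) : A) := by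
  classical
  let M := kummerUnits F L A
  let v : M →* A := (Units.coeHom A).comp M.subtype
  have v_ne : ∀ x, v x ≠ 0 := fun x => (x : Aˣ).ne_zero
  let w : M →* A := ((algebraMap F A).toMonoidHom.comp ((Units.coeHom F).comp χ)) * v
  -- The Kummer character of `x`. It is multiplicative in `τ` because `σ x / x` is a constant, which
  -- `τ` fixes.
  let ev : M → (Gal(A/L) →* A) := fun x =>
    { toFun := fun τ => τ (v x) / v x
      map_one' := div_self (v_ne x)
      map_mul' := fun τ σ => by
        obtain ⟨z, hz⟩ := exists_smul_eq_of_mem_kummerUnits σ x.2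
        have h1 : τ (σ (v x)) = algebraMap F A z * τ (v x) := by
          rw [show σ (v x) = algebraMap F A z * v x from (eq_div_iff (v_ne x)).1 hz |>.symm,
            map_mul, IsScalarTower.algebraMap_apply F L A, τ.commutes]
        rw [AlgEquiv.mul_apply, h1]
        change _ = _ * (σ ((x : Aˣ) : A) / ((x : Aˣ) : A))
        rw [← hz]; ring }
  have hev : ∀ x y, ev x = ev y → χ x = χ y := fun x y hxy => by
    rw [← mul_inv_eq_one, ← map_inv, ← map_mul]
    have hfix : ∀ τ : Gal(A/L), τ (v (x * y⁻¹)) = v (x * y⁻¹) := fun τ => by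
      have h1 : τ (v x) / v x = τ (v y) / v y := DFunLike.congr_fun hxy τ
      have hy : τ (v y) ≠ 0 := (map_ne_zero τ).2 (v_ne y)
      have h2 : v (x * y⁻¹) = v x / v y := by
        rw [eq_div_iff (v_ne y), ← map_mul]; simp
      rw [h2, map_div₀, div_eq_div_iff hy (v_ne y)]
      rw [div_eq_div_iff (v_ne x) (v_ne y)] at h1
      rw [h1, mul_comm]
    obtain ⟨c, hc⟩ := (InfiniteGalois.mem_range_algebraMap_iff_fixed _).2 hfix
    exact hχ _ c hc
  let Ψ := MonoidAlgebra.lift L A M v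
  let Φ := MonoidAlgebra.lift L A M w
  -- Twisting the generators by `χ` must respect every `L`-linear relation among elements of `M`. By
  -- Dedekind independence a relation splits into relations with a fixed Kummer character; on each
  -- of these `χ` is constant by `hev`.
  have hker : ∀ c, Ψ c = 0 → Φ c = 0 := by
    intro c hc
    simp only [Ψ, Φ, MonoidAlgebra.lift_apply, Finsupp.sum] at hc ⊢
    set S := c.coeff.support
    have hlin : ∑ e ∈ S.image ev, (∑ m ∈ S with ev m = e, c.coeff m • v m) • (e : Gal(A/L) → A)
        = 0 := by
      have h1 : ∀ e ∈ S.image ev, (∑ m ∈ S with ev m = e, c.coeff m • v m) • (e : Gal(A/L) → A) =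
          ∑ m ∈ S with ev m = e, (c.coeff m • v m) • (ev m : Gal(A/L) → A) := fun e _ => by
        rw [Finset.sum_smul]
        exact Finset.sum_congr rfl fun m hm => by rw [(Finset.mem_filter.1 hm).2]
      rw [Finset.sum_congr rfl h1,
        Finset.sum_fiberwise_of_maps_to (fun m hm => Finset.mem_image_of_mem ev hm)]
      funext τ
      rw [Finset.sum_apply]
      have h2 : ∀ m ∈ S, ((c.coeff m • v m) • (ev m : Gal(A/L) → A)) τ = τ (c.coeff m • v m) :=
        fun m _ => by
          change (c.coeff m • v m) * (τ (v m) / v m) = _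
          rw [map_smul, smul_mul_assoc, mul_div_cancel₀ _ (v_ne m)]
      rw [Finset.sum_congr rfl h2, ← map_sum, hc, map_zero]; rfl
    have hz := linearIndependent_iff'.1 (linearIndependent_monoidHom Gal(A/L) A) _ _ hlin
    rw [← Finset.sum_fiberwise_of_maps_to (fun m hm => Finset.mem_image_of_mem ev hm)]
    refine Finset.sum_eq_zero fun e he => ?_
    obtain ⟨m₀, hm₀, rfl⟩ := Finset.mem_image.1 he
    have h3 : ∀ m ∈ S.filter (fun m => ev m = ev m₀),
        c.coeff m • w m = algebraMap F A (χ m₀) * (c.coeff m • v m) := fun m hm => by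
      rw [← hev m m₀ (Finset.mem_filter.1 hm).2, mul_smul_comm]; rfl
    rw [Finset.sum_congr rfl h3, ← Finset.mul_sum, hz _ he, mul_zero]
  -- The subfield generated by `M`. The twist is an embedding of it into `A`, which extends to an
  -- automorphism by normality.
  let E : IntermediateField L A := Ψ.range.toIntermediateField' (Subalgebra.isField_of_algebraic _)
  let e := Ideal.quotientKerAlgEquivOfSurjective Ψ.rangeRestrict_surjective
  let f₀ := Ideal.Quotient.liftₐ (RingHom.ker Ψ.rangeRestrict) Φ
    (fun c hc => hker c (congrArg Subtype.val hc))
  let f : E →ₐ[L] A := f₀.comp e.symm.toAlgHom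
  have hf : ∀ c, f ⟨Ψ c, ⟨c, rfl⟩⟩ = Φ c := fun c => by
    have : e.symm (Ψ.rangeRestrict c) = Ideal.Quotient.mk _ c := by
      rw [AlgEquiv.symm_apply_eq]; rfl
    change f₀ (e.symm (Ψ.rangeRestrict c)) = _
    rw [this]; rfl
  obtain ⟨φ, hφ⟩ := IntermediateField.exists_algHom_of_splits (F := L) (E := A) (K := A) (L := E)
    (fun s : A => ⟨Algebra.IsIntegral.isIntegral (R := L) s, Normal.splits inferInstance s⟩) f
  refine ⟨AlgEquiv.ofBijective φ (Algebra.IsAlgebraic.algHom_bijective φ), fun x => ?_⟩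
  have h1 := DFunLike.congr_fun hφ ⟨Ψ (MonoidAlgebra.single x 1), ⟨_, rfl⟩⟩
  rw [hf] at h1
  simpa [Ψ, Φ, v, w] using h1

open scoped IsMulCommutative in
/-- **Kummer theory**: an automorphism of an abelian extension `A / L` that fixes all elements
with a prime-to-`p` power in `L` is locally of `p`-power order. -/
theorem exists_pow_apply_eq [IsSepClosed F] [IsAbelianGalois L A] (p : ℕ) [ExpChar F p]
    (g : Gal(A/L)) (hg : ∀ x ∈ kummerUnits F L A, g x = x) (x : A) :
    ∃ a : ℕ, (g ^ p ^ a) x = x := by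
  let T := IntermediateField.adjoin L {x}
  have : FiniteDimensional L T :=
    IntermediateField.adjoin.finiteDimensional (Algebra.IsIntegral.isIntegral x)
  let h : Gal(T/L) := AlgEquiv.restrictNormalHom T g
  have hT : ∀ (σ : Gal(A/L)) (y : T), σ y = (AlgEquiv.restrictNormalHom T σ y : T) := fun σ y =>
    (AlgEquiv.restrictNormal_commutes σ T y).symm
  suffices ∃ a : ℕ, h ^ p ^ a = 1 by
    obtain ⟨a, ha⟩ := this
    refine ⟨a, ?_⟩
    have := hT (g ^ p ^ a) ⟨x, IntermediateField.mem_adjoin_simple_self L x⟩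
    rwa [map_pow, ha] at this
  obtain ⟨a, m, hm, hcard⟩ : ∃ a m : ℕ, (m : F) ≠ 0 ∧ Nat.card Gal(T/L) = p ^ a * m := by
    cases ‹ExpChar F p› with
    | zero =>
      exact ⟨0, Nat.card Gal(T/L), Nat.cast_ne_zero.2 Nat.card_pos.ne',
        by rw [pow_zero, one_mul]⟩
    | prime hp =>
      obtain ⟨a, m, hpm, hcard⟩ := Nat.exists_eq_pow_mul_and_not_dvd (n := Nat.card Gal(T/L))
        Nat.card_pos.ne' p hp.ne_one
      exact ⟨a, m, fun h => hpm ((CharP.cast_eq_zero_iff F p m).1 h), hcard⟩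
  refine ⟨a, ?_⟩
  by_contra hne
  -- The image of `P` has exponent dividing `m`, so its characters with values in `Fˣ` separate
  -- points. One that detects `h ^ p ^ a` pulls back to `ψ`.
  let P : Gal(T/L) →* Gal(T/L) := powMonoidHom (p ^ a)
  have hexp : Monoid.exponent P.range ∣ m := Monoid.exponent_dvd_of_forall_pow_eq_one (by
    rintro ⟨_, γ, rfl⟩
    exact Subtype.ext (by
      change (γ ^ p ^ a) ^ m = 1
      rw [← pow_mul, ← hcard, pow_card_eq_one']))
  have hexp0 : NeZero ((Monoid.exponent P.range : ℕ) : F) := ⟨fun h0 => hm (by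
    obtain ⟨b, hb⟩ := hexp
    rw [hb, Nat.cast_mul, h0, zero_mul])⟩
  obtain ⟨χ, hχ⟩ := CommGroup.exists_apply_ne_one_of_hasEnoughRootsOfUnity P.range F
    (a := ⟨P h, h, rfl⟩) (fun h0 => hne (congrArg Subtype.val h0))
  let ψ : Gal(T/L) →* Fˣ := χ.comp P.rangeRestrict
  have hψ : ∀ γ, ψ γ ^ m = 1 := fun γ => by
    rw [← map_pow]
    have : P.rangeRestrict (γ ^ m) = 1 := Subtype.ext (by
      change (γ ^ m) ^ p ^ a = 1
      rw [← pow_mul, mul_comm, ← hcard, pow_card_eq_one'])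
    change χ (P.rangeRestrict (γ ^ m)) = 1
    rw [this, map_one]
  have hcoc : ∀ (γ : Gal(T/L)) (z : F), γ (algebraMap F T z) = algebraMap F T z := fun γ z => by
    rw [IsScalarTower.algebraMap_apply F L T, γ.commutes]
  -- `ψ` takes values in constants, so it is a cocycle. Hilbert 90 yields an eigenvector `y` with
  -- character `ψ`; then `y ^ m` lies in `L`, so `g` fixes `y`, whereas `ψ h ≠ 1`.
  obtain ⟨y, hy⟩ := groupCohomology.isMulCoboundary₁_of_isMulCocycle₁_of_aut_to_units
    (fun γ : Gal(T/L) => Units.map (algebraMap F T).toMonoidHom (ψ γ)) (fun γ δ => Units.ext (by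
      change algebraMap F T (ψ (γ * δ) : Fˣ) = γ (algebraMap F T (ψ δ)) * algebraMap F T (ψ γ)
      rw [hcoc, map_mul, Units.val_mul, map_mul, mul_comm]))
  have hy' : ∀ γ : Gal(T/L), γ (y : T) = algebraMap F T (ψ γ) * y := fun γ => by
    have := hy γ
    rw [div_eq_iff_eq_mul] at this
    exact congrArg Units.val this
  obtain ⟨c, hc⟩ : (y : T) ^ m ∈ Set.range (algebraMap L T) := by
    rw [InfiniteGalois.mem_range_algebraMap_iff_fixed]
    intro γ
    rw [map_pow, hy', mul_pow, ← map_pow, ← Units.val_pow_eq_pow_val, hψ]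
    simp
  have hyM : Units.map (algebraMap T A).toMonoidHom y ∈ kummerUnits F L A :=
    ⟨m, hm, c, by rw [IsScalarTower.algebraMap_apply L T A, hc, map_pow]; rfl⟩
  have h1 : h (y : T) = y := Subtype.ext (by rw [← hT]; exact hg _ hyM)
  rw [hy', mul_eq_right₀ y.ne_zero, map_eq_one_iff _ (algebraMap F T).injective] at h1
  exact hχ (Units.ext h1)

end Kummer

/-! ### From an equivariant retraction to a continuous section. -/

section Retraction

open Topology

theorem eventually_apply_eq {K A : Type*} [Field K] [Field A] [Algebra K A]
    [Algebra.IsIntegral K A] (g : Gal(A/K)) (x : A) : ∀ᶠ g' in 𝓝 g, g' x = g x := by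
  have h := (continuous_const_mul g⁻¹).tendsto g
  rw [inv_mul_cancel] at h
  filter_upwards [h ((stabilizer_isOpen_of_isIntegral (K := K) x).mem_nhds (one_mem _))]
    with g' hg'
  have h1 : g⁻¹ (g' x) = x := hg'
  have h2 := congrArg g h1
  rwa [← AlgEquiv.mul_apply, mul_inv_cancel, AlgEquiv.one_apply] at h2

/-- Take a primitive element of a finite subextension whose fixing subgroup lies in `U`. -/
theorem exists_forall_fixed_imp_mem {K A : Type*} [Field K] [Field A] [Algebra K A]
    [Algebra.IsSeparable K A] {U : Set Gal(A/K)} (hU : U ∈ 𝓝 (1 : Gal(A/K))) :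
    ∃ x : A, ∀ g : Gal(A/K), g x = x → g ∈ U := by
  obtain ⟨T, hT, hTU⟩ := (krullTopology_mem_nhds_one_iff K A U).1 hU
  let pb := Field.powerBasisOfFiniteOfSeparable K T
  refine ⟨(pb.gen : A), fun g hg => hTU ?_⟩
  have h : (g.toAlgHom.comp T.val) = T.val := pb.algHom_ext hg
  rw [SetLike.mem_coe, IntermediateField.mem_fixingSubgroup_iff]
  exact fun y hy => DFunLike.congr_fun h ⟨y, hy⟩

variable {k F K L A : Type*} [Field k] [Field F] [Field K] [Field L] [Field A]
  [Algebra k F] [Algebra K L] [Algebra F L] [Algebra K A] [Algebra L A] [Algebra F A]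
  [IsScalarTower K L A] [IsScalarTower F L A]

/-- Let `A / K` be a Galois extension, abelian over a field `L` on which `Gal(A/K)` acts through
`π : Gal(A/K) → Gal(F/k)`. If `Fˣ` is an equivariant retract of `Lˣ`, then `π` splits. -/
theorem exists_continuous_section_of_retraction [IsSepClosure k F] [IsGalois K A]
    [IsAbelianGalois L A] (π : Gal(A/K) →* Gal(F/k)) (hπ : Continuous π)
    (hs : Function.Surjective π)
    (hF : ∀ g b, g (algebraMap F A b) = algebraMap F A (π g b))
    (hL : ∀ (g : Gal(A/K)) (y : L), ∃ y', g (algebraMap L A y) = algebraMap L A y')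
    (hker : ∀ g, π g = 1 → ∀ y : L, g (algebraMap L A y) = algebraMap L A y)
    (r : Lˣ →* Fˣ) (hr : ∀ b : Fˣ, r (Units.map (algebraMap F L).toMonoidHom b) = b)
    (hr_equiv : ∀ (g : Gal(A/K)) (x y : Lˣ), g (algebraMap L A x) = algebraMap L A y →
      (r y : F) = π g (r x)) :
    ∃ s : Gal(F/k) →* Gal(A/K), Continuous s ∧ ∀ σ, π (s σ) = σ := by
  have : IsSepClosed F := IsSepClosure.sep_closed k
  let M := kummerUnits F L A
  obtain ⟨R, hR⟩ := exists_monoidHom_kummerUnits (A := A) r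
  have hRF : ∀ (x : M) (b : F), algebraMap F A b = ((x : Aˣ) : A) → (R x : F) = b := by
    intro x b hx
    have hb : b ≠ 0 := by
      rintro rfl
      rw [map_zero] at hx
      exact (x : Aˣ).ne_zero hx.symm
    rw [hR x (Units.map (algebraMap F L).toMonoidHom (Units.mk0 b hb)), hr]
    · rfl
    · rw [← hx, IsScalarTower.algebraMap_apply F L A]; rfl
  let act : Gal(A/K) → M →* M := fun g =>
    ((Units.map (g : A →* A)).comp M.subtype).codRestrict M fun x => by
      obtain ⟨n, hn, y, hy⟩ := x.2
      obtain ⟨y', hy'⟩ := hL g y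
      exact ⟨n, hn, y', by rw [← hy', hy, map_pow]; rfl⟩
  have act_val : ∀ g x, ((act g x : Aˣ) : A) = g ((x : Aˣ) : A) := fun g x => rfl
  have act_mul : ∀ g h x, act (g * h) x = act g (act h x) := fun g h x => rfl
  have act_one : ∀ x, act 1 x = x := fun x => rfl
  -- The stabilizer of `R` under the action of `Gal(A/K)` on maps `M → Fˣ`.
  let H₁ : Subgroup Gal(A/K) :=
    { carrier := {g | ∀ x : M, (R (act g x) : F) = π g (R x)}
      one_mem' := fun x => by rw [act_one, map_one]; rfl
      mul_mem' := fun {g h} hg hh x => by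
        rw [act_mul, hg, hh, map_mul]; rfl
      inv_mem' := fun {g} hg x => by
        have h1 := hg (act g⁻¹ x)
        rw [← act_mul, mul_inv_cancel, act_one] at h1
        rw [h1, ← AlgEquiv.mul_apply, ← map_mul, inv_mul_cancel, map_one]; rfl }
  have toGal : ∀ g, π g = 1 → ∃ τ : Gal(A/L), ∀ x, τ x = g x := fun g hg =>
    ⟨AlgEquiv.ofRingEquiv (f := (g : A ≃+* A)) (hker g hg), fun x => rfl⟩
  refine exists_continuous_section_of_pro_p_kernel (ringExpChar F) π hπ H₁ ?_ ?_ ?_ ?_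
  · have h1 : (H₁ : Set Gal(A/K)) = ⋂ x : M, {g | (R (act g x) : F) = π g (R x)} := by
      ext g; simp only [Set.mem_iInter]; rfl
    rw [h1]
    refine isClosed_iInter fun x => ?_
    rw [← isOpen_compl_iff, isOpen_iff_mem_nhds]
    intro g hg
    filter_upwards [eventually_apply_eq g ((x : Aˣ) : A),
      hπ.continuousAt.eventually (eventually_apply_eq (π g) (R x : F))] with g' h1 h2
    have h3 : act g' x = act g x := Subtype.ext (Units.ext h1)
    change ¬ (R (act g' x) : F) = π g' (R x)
    rw [h2, h3]
    exact hg
  · rw [eq_top_iff]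
    rintro σ -
    obtain ⟨g, rfl⟩ := hs σ
    -- The conjugate of `R` by `g`, divided by `R`; equivariance of `r` makes it trivial on `Lˣ`.
    let χ : M →* Fˣ := ((Units.map (π g : F →* F)).comp (R.comp (act g⁻¹))) / R
    have χ_val : ∀ x, (χ x : F) * R x = π g (R (act g⁻¹ x)) := fun x => by
      have : χ x * R x = Units.map (π g : F →* F) (R (act g⁻¹ x)) := div_mul_cancel _ _
      exact congrArg Units.val this
    have hχ : ∀ (x : M) (y : L), algebraMap L A y = ((x : Aˣ) : A) → χ x = 1 := by
      intro x y hxy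
      obtain ⟨z, hz⟩ := hL g⁻¹ y
      have hy0 : y ≠ 0 := by
        rintro rfl
        rw [map_zero] at hxy
        exact (x : Aˣ).ne_zero hxy.symm
      have hz0 : z ≠ 0 := by
        rintro rfl
        rw [map_zero, map_eq_zero, map_eq_zero] at hz
        exact hy0 hz
      have h1 := hr_equiv g (Units.mk0 z hz0) (Units.mk0 y hy0) (by
        rw [Units.val_mk0, Units.val_mk0, ← hz, ← AlgEquiv.mul_apply, mul_inv_cancel]; rfl)
      rw [← hR x (Units.mk0 y hy0) hxy, ← hR (act g⁻¹ x) (Units.mk0 z hz0)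
        (by rw [act_val, ← hxy, hz]; rfl), ← χ_val] at h1
      exact Units.ext ((mul_eq_right₀ (R x).ne_zero).1 h1.symm)
    obtain ⟨τ, hτ⟩ := exists_gal_smul_eq χ hχ
    let τ' : Gal(A/K) := τ.restrictScalars K
    have hτ' : π τ' = 1 := by
      ext b
      apply (algebraMap F A).injective
      rw [← hF]
      change τ _ = algebraMap F A b
      rw [IsScalarTower.algebraMap_apply F L A, τ.commutes]
    refine ⟨τ' * g, fun x => ?_, by rw [map_mul, hτ', one_mul]⟩
    have hconst : algebraMap F A (χ (act g x)) ≠ 0 := by simp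
    let c : M := ⟨Units.mk0 _ hconst, 1, by simp, algebraMap F L (χ (act g x)), by
      rw [← IsScalarTower.algebraMap_apply F L A]; simp⟩
    have h1 : act (τ' * g) x = c * act g x := Subtype.ext (Units.ext (hτ (act g x)))
    rw [h1, map_mul, Units.val_mul, hRF c _ rfl, χ_val, ← act_mul, inv_mul_cancel, act_one,
      map_mul, hτ', one_mul]
  · intro m n hm hn
    obtain ⟨m', hm'⟩ := toGal m hm
    obtain ⟨n', hn'⟩ := toGal n hn
    have hcomm : m' * n' = n' * m' := IsMulCommutative.is_comm.comm m' n'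
    ext x
    have := DFunLike.congr_fun hcomm x
    simpa only [AlgEquiv.mul_apply, hm', hn'] using this
  · intro n hn hn1 U hU
    obtain ⟨τ, hτ⟩ := toGal n hn1
    obtain ⟨x, hx⟩ := exists_forall_fixed_imp_mem hU
    -- Here `τ y = z * y` with `z` constant. Since `n ∈ H₁` acts trivially on `F`, `R (τ y) = R y`,
    -- and `R` is the identity on constants, so `z = 1`.
    obtain ⟨a, ha⟩ := exists_pow_apply_eq (F := F) (ringExpChar F) τ (fun y hy => by
      obtain ⟨z, hz⟩ := exists_smul_eq_of_mem_kummerUnits τ hy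
      have hz' : τ y = algebraMap F A z * y := by rw [hz, div_mul_cancel₀ _ y.ne_zero]
      have hz0 : algebraMap F A z ≠ 0 := fun h0 => by
        rw [h0, zero_mul, map_eq_zero] at hz'
        exact y.ne_zero hz'
      let c : M := ⟨Units.mk0 _ hz0, 1, by simp, algebraMap F L z, by
        rw [← IsScalarTower.algebraMap_apply F L A]; simp⟩
      have h1 : act n ⟨y, hy⟩ = c * ⟨y, hy⟩ :=
        Subtype.ext (Units.ext ((hτ y).symm.trans hz'))
      have h2 := hn ⟨y, hy⟩
      rw [h1, map_mul, Units.val_mul, hRF c z rfl, hn1, AlgEquiv.one_apply,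
        mul_eq_right₀ (R _).ne_zero] at h2
      rw [hz', h2, map_one, one_mul]) x
    refine ⟨a, hx _ ?_⟩
    have hpow : ∀ (j : ℕ) (z : A), (τ ^ j) z = (n ^ j) z := fun j => by
      induction j with
      | zero => exact fun z => rfl
      | succ j ih =>
        exact fun z => by
          rw [pow_succ, pow_succ, AlgEquiv.mul_apply, AlgEquiv.mul_apply, ih, hτ]
    rw [← hpow, ha]

end Retraction

/-! ### The maximal abelian subextension as a fixed field. -/

section MaximalAbelian

variable (K L Ω : Type*) [Field K] [Field L] [Field Ω] [Algebra L Ω]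

open scoped commutatorElement in
theorem isAbelianGalois_fixedField_commutator [IsGalois L Ω] :
    IsAbelianGalois L (IntermediateField.fixedField (commutator Gal(Ω/L))) := by
  set B := IntermediateField.fixedField (commutator Gal(Ω/L))
  have : IsGalois L B := IsGalois.of_fixedField_normal_subgroup _
  refine { is_comm.comm := fun σ τ => ?_ }
  obtain ⟨σ, rfl⟩ := AlgEquiv.restrictNormalHom_surjective (F := L) (K₁ := B) Ω σ
  obtain ⟨τ, rfl⟩ := AlgEquiv.restrictNormalHom_surjective (F := L) (K₁ := B) Ω τ
  rw [← map_mul, ← map_mul, MonoidHom.eq_iff, IntermediateField.restrictNormalHom_ker,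
    IntermediateField.mem_fixingSubgroup_iff]
  intro x hx
  refine (IntermediateField.mem_fixedField_iff _ _).1 hx _ ?_
  have : (τ * σ)⁻¹ * (σ * τ) = ⁅σ⁻¹, τ⁻¹⁆ := by rw [commutatorElement_def]; group
  rw [this]
  exact Subgroup.commutator_mem_commutator (Subgroup.mem_top _) (Subgroup.mem_top _)

open scoped IsMulCommutative in
theorem maximalAbelianSubextension_eq [IsGalois L Ω] :
    maximalAbelianSubextension L Ω = IntermediateField.fixedField (commutator Gal(Ω/L)) := by
  refine le_antisymm (sSup_le fun E hE => ?_) (le_sSup (isAbelianGalois_fixedField_commutator L Ω))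
  have hE' : IsAbelianGalois L E := hE
  intro x hx
  rw [IntermediateField.mem_fixedField_iff]
  intro c hc
  have h1 : c ∈ (AlgEquiv.restrictNormalHom (F := L) (K₁ := Ω) E).ker :=
    Abelianization.commutator_subset_ker _ hc
  rw [IntermediateField.restrictNormalHom_ker] at h1
  exact (IntermediateField.mem_fixingSubgroup_iff _ _).1 h1 x hx

instance [IsGalois L Ω] : IsAbelianGalois L (maximalAbelianSubextension L Ω) := by
  rw [maximalAbelianSubextension_eq]
  exact isAbelianGalois_fixedField_commutator L Ω

variable [Algebra K L] [Algebra K Ω] [IsScalarTower K L Ω]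

/-- An automorphism over `K` preserves `L`, hence normalizes `Gal(Ω/L)` and its commutator subgroup,
and so preserves the fixed field of the latter. -/
theorem isGalois_maximalAbelianSubextension [IsSepClosure L Ω] [Algebra.IsSeparable K L]
    (hL : ∀ (φ : Gal(Ω/K)) (y : L), ∃ y', φ (algebraMap L Ω y) = algebraMap L Ω y') :
    IsGalois K (maximalAbelianSubextension L Ω) := by
  have : Algebra.IsSeparable K Ω := Algebra.IsSeparable.trans K L Ω
  have : IsSepClosure K Ω := ⟨IsSepClosure.sep_closed L, this⟩
  let B := maximalAbelianSubextension L Ω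
  have hn : Normal K (B.restrictScalars K) := by
    rw [IntermediateField.normal_iff_forall_map_le']
    rintro φ _ ⟨x, hx, rfl⟩
    replace hx : x ∈ B := hx
    change φ x ∈ B
    simp only [B, maximalAbelianSubextension_eq, IntermediateField.mem_fixedField_iff] at hx ⊢
    have hconj : ∀ a : Gal(Ω/L), ∃ a' : Gal(Ω/L), ∀ z, a' z = φ.symm (a (φ z)) := fun a =>
      ⟨AlgEquiv.ofRingEquiv (f := ((φ.trans (a.restrictScalars K)).trans φ.symm : Ω ≃+* Ω))
        (fun y => by
          obtain ⟨y', hy'⟩ := hL φ y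
          change φ.symm (a (φ _)) = _
          rw [hy', a.commutes, ← hy', AlgEquiv.symm_apply_apply]), fun z => rfl⟩
    choose conj hconj using hconj
    let Φ : Gal(Ω/L) →* Gal(Ω/L) := MonoidHom.mk' conj fun a b => by
      ext z
      simp [hconj]
    intro c hc
    have h1 : Φ c ∈ commutator Gal(Ω/L) := by
      have := Subgroup.mem_map_of_mem Φ hc
      rw [commutator_def, Subgroup.map_commutator] at this
      exact Subgroup.commutator_mono le_top le_top this
    have h2 := hx _ h1
    change conj c x = x at h2
    rw [hconj, AlgEquiv.symm_apply_eq] at h2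
    exact h2
  have hs : Algebra.IsSeparable K (B.restrictScalars K) := inferInstance
  have hg : IsGalois K (B.restrictScalars K) := {}
  exact hg

end MaximalAbelian

/-- A neighbourhood of `1` in `Gal(F/k)` contains the stabilizer of one element, and the stabilizer
of its image in `A` is open. -/
theorem continuous_of_forall_apply_algebraMap {k F K A : Type*} [Field k] [Field F] [Field K]
    [Field A] [Algebra k F] [Algebra K A] [Algebra F A] [Algebra.IsSeparable k F]
    [Algebra.IsIntegral K A] (π : Gal(A/K) →* Gal(F/k))
    (hF : ∀ g b, g (algebraMap F A b) = algebraMap F A (π g b)) : Continuous π := by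
  refine continuous_of_continuousAt_one π fun U hU => ?_
  rw [map_one] at hU
  obtain ⟨x, hx⟩ := exists_forall_fixed_imp_mem hU
  rw [Filter.mem_map]
  filter_upwards [eventually_apply_eq 1 (algebraMap F A x)] with g hg
  exact hx _ ((algebraMap F A).injective (by rw [← hF, hg]; rfl))

open AlgebraicGeometry

/-! ### The exact sequence for the function field. -/

section ElementaryObstruction

variable {k : Type u} [Field k] {X : Scheme.{u}} (f : X ⟶ Spec (.of k))
  [Smooth f] [GeometricallyIrreducible f]
  (F : Type u) [Field F] [Algebra k F] [IsSepClosure k F]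

/-- If the elementary obstruction vanishes, `k̄ˣ` is an equivariant retract of `k̄(X)ˣ`. -/
theorem exists_retraction_of_elementaryObstruction_eq_zero (hob : elementaryObstruction f F = 0) :
    ∃ r : (GeomFunctionField f F)ˣ →* Fˣ,
      (∀ b, r (Units.map (algebraMap F (GeomFunctionField f F)).toMonoidHom b) = b) ∧
      ∀ (σ : Gal(F/k)) x, r (σ • x) = σ • r x := by
  obtain ⟨φ, h1, h2, -⟩ := Quotient.exact hob
  refine ⟨(MonoidHom.fst _ _).comp φ.toMonoidHom, fun b => ?_, fun σ x => ?_⟩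
  · exact congrArg Prod.fst (h2 b)
  · exact congrArg Prod.fst (h1 σ x)

variable {f F}

theorem GeomFunctionField.induction {P : GeomFunctionField f F → Prop} (x : GeomFunctionField f F)
    (hmul : ∀ (a : FunctionField f) (b : F), P (algebraMap _ _ a * algebraMap _ _ b))
    (hadd : ∀ x y, P x → P y → P (x + y)) : P x := by
  have htmul : ∀ (a : FunctionField f) (b : F),
      (a ⊗ₜ[k] b : FunctionField f ⊗[k] F) = (algebraMap _ (GeomFunctionField f F) a *
        algebraMap _ (GeomFunctionField f F) b : GeomFunctionField f F) := fun a b =>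
    (congrArg₂ (· ⊗ₜ[k] ·) (mul_one a).symm (one_mul b).symm).trans
      (Algebra.TensorProduct.tmul_mul_tmul a 1 1 b).symm
  change FunctionField f ⊗[k] F at x
  induction x with
  | zero =>
    have := hmul 0 0
    rwa [map_zero, zero_mul] at this
  | tmul a b => rw [htmul]; exact hmul a b
  | add x y hx hy => exact hadd x y hx hy

theorem isSeparable_geomFunctionField :
    Algebra.IsSeparable (FunctionField f) (GeomFunctionField f F) := by
  rw [← separableClosure.eq_top_iff, eq_top_iff]
  rintro x -
  induction x using GeomFunctionField.induction with
  | hmul a b =>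
    refine mul_mem (IntermediateField.algebraMap_mem _ a) ?_
    rw [mem_separableClosure_iff]
    have : IsSeparable k b := Algebra.IsSeparable.isSeparable k b
    exact (this.map (IsScalarTower.toAlgHom k F (GeomFunctionField f F))
      (algebraMap F (GeomFunctionField f F)).injective).tower_top (FunctionField f)
  | hadd x y hx hy => exact add_mem hx hy

theorem apply_algebraMap_eq_galAction {A : Type*} [Field A] [Algebra (GeomFunctionField f F) A]
    (φ : A →+* A) (σ : Gal(F/k))
    (hK : ∀ a : FunctionField f, φ (algebraMap (GeomFunctionField f F) A (algebraMap _ _ a)) =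
      algebraMap (GeomFunctionField f F) A (algebraMap _ _ a))
    (hF : ∀ b : F, φ (algebraMap (GeomFunctionField f F) A (algebraMap _ _ b)) =
      algebraMap (GeomFunctionField f F) A (algebraMap _ _ (σ b))) (x : GeomFunctionField f F) :
    φ (algebraMap (GeomFunctionField f F) A x) =
      algebraMap (GeomFunctionField f F) A (galAction f F σ x) := by
  induction x using GeomFunctionField.induction with
  | hmul a b =>
    rw [map_mul, map_mul, map_mul (galAction f F σ), map_mul, hK, hF, AlgEquiv.commutes,
      galAction_algebraMap]
  | hadd x y hx hy => rw [map_add, map_add, map_add (galAction f F σ), map_add, hx, hy]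

variable (f F) (Ω : Type u) [Field Ω] [Algebra (GeomFunctionField f F) Ω]

theorem apply_algebraMap_eq_abProjection (g : Gal(GeomFunctionFieldAb f F Ω/FunctionField f))
    (b : F) : g (algebraMap F (GeomFunctionFieldAb f F Ω) b) =
      algebraMap F (GeomFunctionFieldAb f F Ω) (abProjection f F Ω g b) :=
  (AlgEquiv.restrictNormal_commutes (AlgEquiv.restrictScalarsHom k g) F b).symm

theorem apply_algebraMap_eq_galAction_abProjection
    (g : Gal(GeomFunctionFieldAb f F Ω/FunctionField f)) (x : GeomFunctionField f F) :
    g (algebraMap _ (GeomFunctionFieldAb f F Ω) x) =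
      algebraMap _ (GeomFunctionFieldAb f F Ω) (galAction f F (abProjection f F Ω g) x) :=
  apply_algebraMap_eq_galAction (g : GeomFunctionFieldAb f F Ω →+* GeomFunctionFieldAb f F Ω) _
    (fun a => g.commutes a) (apply_algebraMap_eq_abProjection f F Ω g) x

theorem range_abInclusion : (abInclusion f F Ω).range = (abProjection f F Ω).ker := by
  ext g
  constructor
  · rintro ⟨τ, rfl⟩
    rw [MonoidHom.mem_ker]
    ext b
    apply (algebraMap F (GeomFunctionFieldAb f F Ω)).injective
    rw [← apply_algebraMap_eq_abProjection]
    exact τ.commutes (algebraMap F (GeomFunctionField f F) b)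
  · intro hg
    rw [MonoidHom.mem_ker] at hg
    refine ⟨AlgEquiv.ofRingEquiv
      (f := (g : GeomFunctionFieldAb f F Ω ≃+* GeomFunctionFieldAb f F Ω)) fun x => ?_, rfl⟩
    have := apply_algebraMap_eq_galAction_abProjection f F Ω g x
    rwa [hg, map_one] at this

variable [IsSepClosure (GeomFunctionField f F) Ω]

instance : IsAbelianGalois (GeomFunctionField f F) (GeomFunctionFieldAb f F Ω) :=
  inferInstanceAs (IsAbelianGalois (GeomFunctionField f F)
    (maximalAbelianSubextension (GeomFunctionField f F) Ω))

instance : IsGalois (FunctionField f) (GeomFunctionFieldAb f F Ω) := by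
  let L := GeomFunctionField f F
  let _ : Algebra (FunctionField f) Ω := Algebra.compHom _ (algebraMap (FunctionField f) L)
  have : IsScalarTower (FunctionField f) L Ω := IsScalarTower.of_algebraMap_eq' rfl
  have : Algebra.IsSeparable (FunctionField f) L := isSeparable_geomFunctionField
  have hL : ∀ (φ : Gal(Ω/FunctionField f)) (y : L),
      ∃ y', φ (algebraMap L Ω y) = algebraMap L Ω y' := by
    intro φ y
    induction y using GeomFunctionField.induction with
    | hmul a b =>
      -- `φ` sends a constant `b` to a root of its minimal polynomial over `k`, which already splits
      -- in `F`; so constants go to constants.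
      have hb : ((minpoly k b).map (algebraMap k F)).Splits := Normal.splits inferInstance b
      obtain ⟨b', hb'⟩ := hb.mem_range_of_isRoot
        (Polynomial.map_ne_zero (minpoly.ne_zero (Algebra.IsIntegral.isIntegral b)))
        (i := (algebraMap L Ω).comp (algebraMap F L)) (x := φ (algebraMap L Ω (algebraMap F L b)))
        (by
          have hcomp : ((algebraMap L Ω).comp (algebraMap F L)).comp (algebraMap k F) =
              (φ : Ω →+* Ω).comp
                (((algebraMap L Ω).comp (algebraMap F L)).comp (algebraMap k F)) := by
            ext c
            change algebraMap L Ω (algebraMap F L (algebraMap k F c)) =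
              φ (algebraMap L Ω (algebraMap F L (algebraMap k F c)))
            rw [← IsScalarTower.algebraMap_apply k F L,
              IsScalarTower.algebraMap_apply k (FunctionField f) L]
            exact (φ.commutes (algebraMap k (FunctionField f) c)).symm
          rw [Polynomial.map_map, hcomp, Polynomial.IsRoot.def, Polynomial.eval_map]
          change Polynomial.eval₂ _ ((φ : Ω →+* Ω) _) _ = 0
          rw [← Polynomial.hom_eval₂]
          have h0 : Polynomial.eval₂ (algebraMap k F) b (minpoly k b) = 0 := minpoly.aeval k b
          have := congrArg ((algebraMap L Ω).comp (algebraMap F L)) h0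
          rw [Polynomial.hom_eval₂, map_zero] at this
          change φ (Polynomial.eval₂ _ ((algebraMap L Ω).comp (algebraMap F L) b) _) = 0
          rw [this, map_zero])
      refine ⟨algebraMap _ _ a * algebraMap _ _ b', ?_⟩
      rw [map_mul, map_mul, map_mul, ← hb', ← IsScalarTower.algebraMap_apply (FunctionField f) L Ω,
        φ.commutes]
      rfl
    | hadd x y hx hy =>
      obtain ⟨x', hx⟩ := hx
      obtain ⟨y', hy⟩ := hy
      exact ⟨x' + y', by rw [map_add, map_add, map_add, hx, hy]⟩
  have hg := isGalois_maximalAbelianSubextension (FunctionField f) L Ω hL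
  exact @IsGalois.of_algEquiv _ _ _ _ _ _ _ _ hg (AlgEquiv.ofRingEquiv
    (f := RingEquiv.refl (maximalAbelianSubextension L Ω)) fun _ => rfl)

theorem abProjection_surjective : Function.Surjective (abProjection f F Ω) := by
  intro σ
  let g : Gal(GeomFunctionFieldAb f F Ω/FunctionField f) :=
    (galAction f F σ).liftNormal (GeomFunctionFieldAb f F Ω)
  refine ⟨g, ?_⟩
  ext b
  apply (algebraMap F (GeomFunctionFieldAb f F Ω)).injective
  rw [← apply_algebraMap_eq_abProjection]
  exact ((galAction f F σ).liftNormal_commutes (GeomFunctionFieldAb f F Ω)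
    (algebraMap F (GeomFunctionField f F) b)).trans
    (congrArg (algebraMap (GeomFunctionField f F) (GeomFunctionFieldAb f F Ω))
      (galAction_algebraMap f F σ b))

end ElementaryObstruction

end BirationalSections

open BirationalSections in
/-- Let `f : X ⟶ Spec k` be a smooth and geometrically irreducible variety over a field `k`, let
`F` be a separable closure of `k` and `Ω` a separable closure of `k̄(X) = k(X) ⊗[k] F`.
If the elementary obstruction of `X` vanishes, then the exact sequence of profinite groups
`1 → Gal(k̄(X)^ab / k̄(X)) → Gal(k̄(X)^ab / k(X)) → Gal(F / k) → 1` splits. -/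
theorem corollary3p8 {k : Type u} [Field k] {X : AlgebraicGeometry.Scheme.{u}}
    (f : X ⟶ AlgebraicGeometry.Spec (.of k))
    [AlgebraicGeometry.IsSeparated f] [AlgebraicGeometry.LocallyOfFiniteType f]
    [AlgebraicGeometry.QuasiCompact f]
    [AlgebraicGeometry.Smooth f] [AlgebraicGeometry.GeometricallyIrreducible f]
    (F : Type u) [Field F] [Algebra k F] [IsSepClosure k F]
    (Ω : Type u) [Field Ω] [Algebra (BirationalSections.GeomFunctionField f F) Ω]
    [IsSepClosure (BirationalSections.GeomFunctionField f F) Ω]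
    (hob : BirationalSections.elementaryObstruction f F = 0) :
    BirationalSections.IsSplitShortExact
      (BirationalSections.abInclusion f F Ω) (BirationalSections.abProjection f F Ω) := by
  obtain ⟨r, hr, hr_equiv⟩ := exists_retraction_of_elementaryObstruction_eq_zero f F hob
  refine
    { injective := AlgEquiv.restrictScalars_injective _
      range_eq_ker := range_abInclusion f F Ω
      surjective := abProjection_surjective f F Ω
      exists_section := exists_continuous_section_of_retraction (abProjection f F Ω)
        (continuous_of_forall_apply_algebraMap _ (apply_algebraMap_eq_abProjection f F Ω))
        (abProjection_surjective f F Ω) (apply_algebraMap_eq_abProjection f F Ω)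
        (fun g y => ⟨_, apply_algebraMap_eq_galAction_abProjection f F Ω g y⟩)
        (fun g hg y => ?_) r hr (fun g x y hxy => ?_) }
  · rw [apply_algebraMap_eq_galAction_abProjection, hg, map_one]; rfl
  · rw [apply_algebraMap_eq_galAction_abProjection] at hxy
    have : y = abProjection f F Ω g • x := Units.ext ((algebraMap _ _).injective hxy.symm)
    rw [this, hr_equiv]; rfl
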